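/- There is an absolute constant $C>0$ such that the following holds. Let $\{X_i\}_{i\ge 1}$ be i.i.d. real random variables with $\mu:=\mathbb{E}[X_1]>0$, $\sigma^2:=\mathrm{Var}(X_1)>0$ and $\mathbb{E}|X_1|^3<\infty$. Let $\{Y_i\}_{i\ge 1}$ be i.i.d. non-negative integer valued random variables with $\nu:=\mathbb{E}[Y_1]>0$, $\tau^2:=\mathrm{Var}(Y_1)>0$ and $\mathbb{E}[Y_1^3]<\infty$, and assume that the sequences $\{X_i\}_{i\ge1}$ and $\{Y_i\}_{i\ge1}$ are independent of each other. Let $\sigma,\tau>0$ be the positive square roots of $\sigma^2,\tau^2$, let $N_n=\sum_{i=1}^n Y_i$, and let $\Phi$ be the standard normal distribution function. Then for every $n\ge 1$, $$\sup_{z\in\mathbb{R}}\left|\mathbb{P}\left(\frac{\sum_{i=1}^{N_n}X_i-n\mu\nu}{\sqrt{n(\nu\sigma^2+\tau^2\mu^2)}}\le z\right)-\Phi(z)\right|\le C\,n^{-1/2}\left(\frac{\tau^2}{\nu^2}+\frac{\mathbb{E}[Y_1^3]}{\tau^3}+\frac{\mathbb{E}|X_1|^3}{\nu^{1/2}\sigma^3}+\frac{\sigma}{\mu\sqrt{\nu}}\right).$$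 The constant $C$ does not depend on $n$ nor on the distributions of $X_1$ and $Y_1$. -/

import Mathlib

open MeasureTheory ProbabilityTheory

universe u

/-!
A random sum is handled by two applications of the Berry–Esseen theorem for a fixed number of
summands. Write `S_N - nμν = (S_N - μN) + μ(N - nν)`. Given `N`, the first term is approximately
normal with variance `σ²N`, by Berry–Esseen for the `X i`; replacing `σ²N` by `σ²nν` costs a multiple
of `𝔼|N / (nν) - 1| ≤ τ / (ν√n)` (`abs_integral_comp_sub_cdf_le`). The random sum then has nearly the
law of `μ(N - nν) + σ√(nν) Z` with an independent standard normal `Z`, and Berry–Esseen for the `Y i`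
replaces `μ(N - nν)` by a normal variable with variance `nτ²μ²` (`abs_integral_cdf_sub_cdf_le`). The
two normal variables add up to the limit. As `𝔼[Y³] / τ³` is bounded below, `τ / ν` is dominated by
`τ² / ν² + 𝔼[Y³] / τ³`.

The Berry–Esseen theorem (`berry_esseen`, from `exists_abs_cdf_convPow_sub_le`) is proved by
Lindeberg's replacement method and induction on the number `n` of summands, normalised to mean zero,
variance one and third absolute moment at most `ρ`. An independent normal variable with variance
`a = (Kρ)²` is added, and the summands are replaced one by one by standard normal ones. At the `k`-th
replacement the rest is a sum of `k` original summands and a normal variable with variance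
`t = n - 1 - k + a`. Its distribution function is a normal one with variance `k + t ≥ n`, plus
`D ∗ N(0, t)` where `D`, the error for `k` summands, has supremum `δ_k`. Since the two laws exchanged
share their first two moments, only third order Taylor remainders matter
(`exists_hasCubicRemainder_integral_gaussianReal`), and the replacement costs a multiple of
`ρ (n ^ (-3/2) + δ_k t ^ (-3/2))` (`exists_abs_cdf_convPow_succ_sub_le`). With `δ_k ≤ Cρ / √k` for
`k ≥ n / 2` and `δ_k ≤ 1` before, the sum over `k` is a multiple of `ρ / √n * (1 + C / K)`. Removing
the added normal variable costs a multiple of `√a / √n = Kρ / √n`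
(`abs_le_of_abs_integral_sub_gaussianReal_le`), so the induction closes once `K`, and then `C`, is
large enough.
-/

/-! ### Distribution functions of convolutions -/

lemma cdf_conv (A B : Measure ℝ) [IsProbabilityMeasure A] [IsProbabilityMeasure B] (y : ℝ) :
    cdf (A ∗ B) y = ∫ u, cdf A (y - u) ∂B := by
  have hm : Measurable fun u => cdf A (y - u) :=
    (monotone_cdf A).measurable.comp (measurable_const.sub measurable_id)
  rw [Measure.conv_comm, integral_eq_lintegral_of_nonneg_ae
    (Filter.Eventually.of_forall fun u => cdf_nonneg A _) hm.aestronglyMeasurable,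
    cdf_eq_real, measureReal_def]
  congr 1
  rw [← lintegral_indicator_one measurableSet_Iic,
    Measure.lintegral_conv (measurable_one.indicator measurableSet_Iic)]
  refine lintegral_congr fun u => ?_
  rw [ofReal_cdf, ← lintegral_indicator_one measurableSet_Iic]
  refine lintegral_congr fun v => ?_
  simp only [Set.indicator, Set.mem_Iic, le_sub_iff_add_le, add_comm, Pi.one_apply]

lemma measurable_cdf (μ : Measure ℝ) : Measurable (cdf μ) := (monotone_cdf μ).measurable

lemma abs_cdf_sub_cdf_le_one (μ ν : Measure ℝ) (x : ℝ) : |cdf μ x - cdf ν x| ≤ 1 := by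
  rw [abs_le]
  constructor <;> linarith [cdf_nonneg μ x, cdf_le_one μ x, cdf_nonneg ν x, cdf_le_one ν x]

lemma integrable_cdf_sub (μ ν : Measure ℝ) [IsProbabilityMeasure ν] (y : ℝ) :
    Integrable (fun u => cdf μ (y - u)) ν :=
  Integrable.of_bound ((measurable_cdf μ).comp (by fun_prop)).aestronglyMeasurable 1
    (ae_of_all _ fun u => by
      rw [Real.norm_eq_abs, abs_of_nonneg (cdf_nonneg _ _)]; exact cdf_le_one _ _)

lemma cdf_conv_sub_cdf_conv (A B C : Measure ℝ) [IsProbabilityMeasure A] [IsProbabilityMeasure B]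
    [IsProbabilityMeasure C] (y : ℝ) :
    cdf (A ∗ C) y - cdf (B ∗ C) y = ∫ u, (cdf A (y - u) - cdf B (y - u)) ∂C := by
  rw [cdf_conv, cdf_conv, integral_sub (integrable_cdf_sub A C y) (integrable_cdf_sub B C y)]

lemma abs_cdf_conv_sub_le {A B C : Measure ℝ} [IsProbabilityMeasure A] [IsProbabilityMeasure B]
    [IsProbabilityMeasure C] {d : ℝ} (hd : ∀ x, |cdf A x - cdf B x| ≤ d) (y : ℝ) :
    |cdf (A ∗ C) y - cdf (B ∗ C) y| ≤ d := by
  rw [cdf_conv_sub_cdf_conv]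
  have := norm_integral_le_of_norm_le_const (μ := C)
    (f := fun u => cdf A (y - u) - cdf B (y - u)) (ae_of_all _ fun u => hd (y - u))
  simpa using this

/-! ### Smoothing by a normal law -/

lemma inv_sqrt_two_pi_le_one : (√(2 * Real.pi))⁻¹ ≤ 1 := by
  apply inv_le_one_of_one_le₀
  rw [Real.one_le_sqrt]
  linarith [Real.pi_gt_three]

lemma abs_sub_zero_le_of_hasDerivAt {f f' : ℝ → ℝ} (hf : ∀ x, HasDerivAt f (f' x) x) {r B : ℝ}
    (hB : ∀ x, |x| ≤ r → |f' x| ≤ B) {x : ℝ} (hx : |x| ≤ r) : |f x - f 0| ≤ B * |x| := by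
  have hr : 0 ≤ r := (abs_nonneg x).trans hx
  have := (convex_Icc (-r) r).norm_image_sub_le_of_norm_hasDerivWithin_le (f := f) (f' := f')
    (C := B) (x := 0) (y := x) (fun y _ => (hf y).hasDerivWithinAt)
    (fun y hy => hB y (abs_le.2 hy)) ⟨by linarith, hr⟩ (abs_le.1 hx)
  simpa using this

/-- Taylor's inequality at `0`, by three applications of the mean value inequality. -/
lemma abs_taylor_two_le {g g₁ g₂ g₃ : ℝ → ℝ} (h₀ : ∀ x, HasDerivAt g (g₁ x) x)
    (h₁ : ∀ x, HasDerivAt g₁ (g₂ x) x) (h₂ : ∀ x, HasDerivAt g₂ (g₃ x) x) {h K : ℝ}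
    (hK : ∀ x, |x| ≤ |h| → |g₃ x| ≤ K) :
    |g h - (g 0 + g₁ 0 * h + g₂ 0 * h ^ 2 / 2)| ≤ K * |h| ^ 3 := by
  have hK0 : 0 ≤ K := (abs_nonneg _).trans (hK h le_rfl)
  have e₂ : ∀ x, |x| ≤ |h| → |g₂ x - g₂ 0| ≤ K * |h| := fun x hx =>
    (abs_sub_zero_le_of_hasDerivAt h₂ hK hx).trans (by gcongr)
  have e₁ : ∀ x, |x| ≤ |h| → |g₁ x - g₁ 0 - g₂ 0 * x| ≤ K * |h| * |h| := fun x hx => by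
    have hd : ∀ x, HasDerivAt (fun x => g₁ x - g₂ 0 * x) (g₂ x - g₂ 0) x := fun x => by
      simpa using (h₁ x).fun_sub ((hasDerivAt_id x).const_mul (g₂ 0))
    have := (abs_sub_zero_le_of_hasDerivAt hd e₂ hx).trans
      (mul_le_mul_of_nonneg_left hx (by positivity))
    simpa [sub_right_comm] using this
  have hd : ∀ x, HasDerivAt (fun x => g x - g₁ 0 * x - g₂ 0 * x ^ 2 / 2)
      (g₁ x - g₁ 0 - g₂ 0 * x) x := fun x => by
    refine (((h₀ x).fun_sub ((hasDerivAt_id' x).const_mul (g₁ 0))).fun_sub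
      ((((hasDerivAt_id' x).fun_pow 2).const_mul (g₂ 0)).div_const 2)).congr_deriv ?_
    push_cast
    ring
  have := abs_sub_zero_le_of_hasDerivAt hd e₁ (le_refl |h|)
  calc _ = _ := by congr 1; ring
    _ ≤ _ := this
    _ = _ := by ring

/-- The second order expansion of a translated Gaussian. The slower decay `exp (-u ^ 2 / 8)` on the
right absorbs both the polynomial factor of the third derivative and the shift by at most `1`. -/
lemma abs_exp_neg_sq_taylor_le (u : ℝ) {h : ℝ} (hh : |h| ≤ 1) :
    |Real.exp (-(u - h) ^ 2 / 2) - Real.exp (-u ^ 2 / 2) * (1 + u * h + (u ^ 2 - 1) * h ^ 2 / 2)|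
      ≤ 40 * Real.exp (-(1 / 8) * u ^ 2) * |h| ^ 3 := by
  have h₀ : ∀ x, HasDerivAt (fun x => Real.exp (-(u - x) ^ 2 / 2))
      ((u - x) * Real.exp (-(u - x) ^ 2 / 2)) x := fun x => by
    have hu : HasDerivAt (fun x => u - x) (-1) x := by simpa using (hasDerivAt_id x).const_sub u
    refine ((hu.fun_pow 2).fun_neg.div_const 2).exp.congr_deriv ?_
    push_cast; ring
  have h₁ : ∀ x, HasDerivAt (fun x => (u - x) * Real.exp (-(u - x) ^ 2 / 2))
      (((u - x) ^ 2 - 1) * Real.exp (-(u - x) ^ 2 / 2)) x := fun x => by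
    have hu : HasDerivAt (fun x => u - x) (-1) x := by simpa using (hasDerivAt_id x).const_sub u
    refine (hu.fun_mul (h₀ x)).congr_deriv ?_
    ring
  have h₂ : ∀ x, HasDerivAt (fun x => ((u - x) ^ 2 - 1) * Real.exp (-(u - x) ^ 2 / 2))
      (((u - x) ^ 3 - 3 * (u - x)) * Real.exp (-(u - x) ^ 2 / 2)) x := fun x => by
    have hu : HasDerivAt (fun x => u - x) (-1) x := by simpa using (hasDerivAt_id x).const_sub u
    refine (((hu.fun_pow 2).sub_const 1).fun_mul (h₀ x)).congr_deriv ?_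
    push_cast; ring
  have key := abs_taylor_two_le h₀ h₁ h₂ (h := h) (K := 40 * Real.exp (-(1 / 8) * u ^ 2)) ?_
  · refine le_trans (le_of_eq ?_) key
    congr 1; simp; ring
  intro x hx
  have hx1 : |x| ≤ 1 := hx.trans hh
  set w := u - x with hw
  have hw2 : -w ^ 2 / 4 ≤ 1 / 4 + -(1 / 8) * u ^ 2 := by
    have : x ^ 2 ≤ 1 := by rw [← sq_abs]; exact pow_le_one₀ (abs_nonneg _) hx1
    rw [hw]; nlinarith [sq_nonneg (u - 2 * x)]
  have hE : Real.exp (-w ^ 2 / 4) ≤ 2 * Real.exp (-(1 / 8) * u ^ 2) := by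
    refine (Real.exp_le_exp.2 hw2).trans ?_
    rw [Real.exp_add]
    have : Real.exp (1 / 4) ≤ 2 := by
      have := Real.exp_bound_div_one_sub_of_interval (x := 1 / 4) (by norm_num) (by norm_num)
      norm_num at this ⊢; linarith
    gcongr
  have hpoly : |w ^ 3 - 3 * w| ≤ 20 * Real.exp (w ^ 2 / 4) := by
    have := Real.quadratic_le_exp_of_nonneg (x := w ^ 2 / 4) (by positivity)
    refine le_trans ?_ (mul_le_mul_of_nonneg_left this (by norm_num))
    rw [abs_le]
    constructor <;> nlinarith [sq_nonneg (w - 1), sq_nonneg (w + 1), sq_nonneg (w ^ 2 - w),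
      sq_nonneg (w ^ 2 + w)]
  calc |(w ^ 3 - 3 * w) * Real.exp (-w ^ 2 / 2)|
      = |w ^ 3 - 3 * w| * Real.exp (-w ^ 2 / 2) := by rw [abs_mul, Real.abs_exp]
    _ ≤ 20 * Real.exp (w ^ 2 / 4) * Real.exp (-w ^ 2 / 2) := by gcongr
    _ = 20 * Real.exp (-w ^ 2 / 4) := by
      rw [mul_assoc, ← Real.exp_add]; congr 2; ring
    _ ≤ _ := by linarith

/-- The error of the second order Taylor expansion in `h` of the translated standard normal
density `u ↦ φ (u - h)`. -/
noncomputable def gaussianTaylorError (h u : ℝ) : ℝ :=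
  gaussianPDFReal 0 1 (u - h)
    - gaussianPDFReal 0 1 u * (1 + u * h + (u ^ 2 - 1) * h ^ 2 / 2)

lemma integrable_pow_mul_gaussianPDFReal (k : ℕ) :
    Integrable fun u : ℝ => gaussianPDFReal 0 1 u * u ^ k := by
  have h := (memLp_id_gaussianReal (μ := 0) (v := 1) k).integrable_norm_pow' 
  have h' : Integrable (fun u : ℝ => u ^ k) (gaussianReal 0 1) :=
    h.mono (by fun_prop) (by simp)
  rw [gaussianReal_of_var_ne_zero 0 one_ne_zero] at h'
  rw [integrable_withDensity_iff_integrable_smul' (measurable_gaussianPDF 0 1)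
    (by simp [gaussianPDF])] at h'
  simpa [toReal_gaussianPDF] using h'

lemma integrable_gaussianTaylorError (h : ℝ) : Integrable (gaussianTaylorError h) := by
  have h0 := integrable_pow_mul_gaussianPDFReal 0
  have h1 := integrable_pow_mul_gaussianPDFReal 1
  have h2 := integrable_pow_mul_gaussianPDFReal 2
  refine ((integrable_gaussianPDFReal 0 1).comp_sub_right h).sub ?_
  refine ((h0.mul_const (1 - h ^ 2 / 2)).add ((h1.mul_const h).add
    (h2.mul_const (h ^ 2 / 2)))).congr (ae_of_all _ fun u => ?_)
  simp only [Pi.add_apply]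
  ring

/-- The Taylor error of a translated normal density is cubic in `L¹`. -/
lemma exists_integral_abs_gaussianTaylorError_le :
    ∃ c : ℝ, 0 < c ∧ ∀ h, ∫ u, |gaussianTaylorError h u| ≤ c * |h| ^ 3 := by
  set φ := gaussianPDFReal 0 1 with hφ
  have h0 := integrable_pow_mul_gaussianPDFReal 0
  have h2 := integrable_pow_mul_gaussianPDFReal 2
  set I := ∫ u : ℝ, Real.exp (-(1 / 8) * u ^ 2) with hI
  set J := ∫ u : ℝ, φ u * (1 + u ^ 2) with hJ
  have hI0 : 0 ≤ I := integral_nonneg fun u => (Real.exp_pos _).le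
  have hφ0 : ∀ u, 0 ≤ φ u := gaussianPDFReal_nonneg 0 1
  have hJ0 : 0 ≤ J := integral_nonneg fun u => mul_nonneg (hφ0 u) (by positivity)
  have hJi : Integrable fun u : ℝ => φ u * (1 + u ^ 2) := 
    (h0.add h2).congr (ae_of_all _ fun u => by simp only [Pi.add_apply]; ring)
  refine ⟨40 * I + (1 + 2 * J), by positivity, fun h => ?_⟩
  rcases le_total |h| 1 with hh | hh
  -- for `|h| ≤ 1` by Taylor's inequality; for `|h| ≥ 1` each term is bounded separately
  · have hb : ∀ u, |gaussianTaylorError h u| ≤ 40 * |h| ^ 3 * Real.exp (-(1 / 8) * u ^ 2) := by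
      intro u
      have hs : (√(2 * Real.pi * (1 : NNReal)))⁻¹ ≤ 1 := by
        rw [NNReal.coe_one, mul_one]; exact inv_sqrt_two_pi_le_one
      have := abs_exp_neg_sq_taylor_le u hh
      have e : gaussianTaylorError h u = (√(2 * Real.pi * (1 : NNReal)))⁻¹ *
          (Real.exp (-(u - h) ^ 2 / 2)
            - Real.exp (-u ^ 2 / 2) * (1 + u * h + (u ^ 2 - 1) * h ^ 2 / 2)) := by
        simp only [gaussianTaylorError, gaussianPDFReal, sub_zero, NNReal.coe_one, mul_one]
        ring
      rw [e, abs_mul, abs_of_nonneg (by positivity)]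
      refine (mul_le_of_le_one_left (abs_nonneg _) hs).trans (this.trans (le_of_eq (by ring)))
    calc _ ≤ ∫ u : ℝ, 40 * |h| ^ 3 * Real.exp (-(1 / 8) * u ^ 2) :=
          integral_mono (integrable_gaussianTaylorError h).abs
            ((integrable_exp_neg_mul_sq (by norm_num)).const_mul _) hb
      _ = 40 * I * |h| ^ 3 := by rw [integral_const_mul]; ring
      _ ≤ _ := by gcongr; linarith
  · have hb : ∀ u, |gaussianTaylorError h u| ≤
        |h| ^ 3 * φ (u - h) + 2 * |h| ^ 3 * (φ u * (1 + u ^ 2)) := by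
      intro u
      have h3 : 1 ≤ |h| ^ 3 := one_le_pow₀ hh
      have hp : |1 + u * h + (u ^ 2 - 1) * h ^ 2 / 2| ≤ 2 * |h| ^ 3 * (1 + u ^ 2) := by
        have a1 : |h| ≤ |h| ^ 3 := le_self_pow₀ hh (by norm_num)
        have a2 : h ^ 2 ≤ |h| ^ 3 := by
          rw [← sq_abs]; exact pow_le_pow_right₀ hh (by norm_num)
        have b1 : |u * h| ≤ |h| ^ 3 * ((1 + u ^ 2) / 2) := by
          rw [abs_mul, mul_comm]
          refine mul_le_mul a1 ?_ (abs_nonneg _) (by positivity)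
          nlinarith [sq_nonneg (|u| - 1), sq_abs u]
        have b2 : |(u ^ 2 - 1) * h ^ 2 / 2| ≤ |h| ^ 3 * ((1 + u ^ 2) / 2) := by
          rw [mul_comm, mul_div_assoc, abs_mul, abs_of_nonneg (sq_nonneg h)]
          refine mul_le_mul a2 ?_ (abs_nonneg _) (by positivity)
          rw [abs_le]; constructor <;> nlinarith [sq_nonneg u]
        calc _ ≤ |1 + u * h| + |(u ^ 2 - 1) * h ^ 2 / 2| := abs_add_le _ _
          _ ≤ |(1 : ℝ)| + |u * h| + |(u ^ 2 - 1) * h ^ 2 / 2| := by gcongr; exact abs_add_le _ _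
          _ ≤ _ := by rw [abs_one]; nlinarith [sq_nonneg u]
      calc _ ≤ |φ (u - h)| + |φ u * (1 + u * h + (u ^ 2 - 1) * h ^ 2 / 2)| := abs_sub _ _
        _ ≤ φ (u - h) + φ u * (2 * |h| ^ 3 * (1 + u ^ 2)) := by
          rw [abs_of_nonneg (hφ0 _), abs_mul, abs_of_nonneg (hφ0 _)]
          gcongr
          exact hφ0 u
        _ ≤ _ := by nlinarith [hφ0 (u - h)]
    have hs : Integrable fun u => φ (u - h) := (integrable_gaussianPDFReal 0 1).comp_sub_right h
    calc _ ≤ ∫ u : ℝ, |h| ^ 3 * φ (u - h) + 2 * |h| ^ 3 * (φ u * (1 + u ^ 2)) :=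
          integral_mono (integrable_gaussianTaylorError h).abs
            ((hs.const_mul _).add (hJi.const_mul _)) hb
      _ = |h| ^ 3 * 1 + 2 * |h| ^ 3 * J := by
        rw [integral_add (hs.const_mul _) (hJi.const_mul _), integral_const_mul,
          integral_const_mul, integral_sub_right_eq_self φ h,
          integral_gaussianPDFReal_eq_one 0 one_ne_zero]
      _ = (1 + 2 * J) * |h| ^ 3 := by ring
      _ ≤ _ := by rw [add_mul (40 * I)]; exact le_add_of_nonneg_left (by positivity)

/-- `f` has everywhere a second order Taylor expansion with remainder at most `M * |h| ^ 3`. -/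
def HasCubicRemainder (f : ℝ → ℝ) (M : ℝ) : Prop :=
  ∀ y, ∃ f₀ f₁ f₂ : ℝ, ∀ h, |f (y + h) - (f₀ + f₁ * h + f₂ * h ^ 2)| ≤ M * |h| ^ 3

lemma HasCubicRemainder.add {f g : ℝ → ℝ} {M N : ℝ} (hf : HasCubicRemainder f M)
    (hg : HasCubicRemainder g N) : HasCubicRemainder (fun y => f y + g y) (M + N) := by
  intro y
  obtain ⟨f₀, f₁, f₂, hf⟩ := hf y
  obtain ⟨g₀, g₁, g₂, hg⟩ := hg y
  refine ⟨f₀ + g₀, f₁ + g₁, f₂ + g₂, fun h => ?_⟩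
  calc _ = |(f (y + h) - (f₀ + f₁ * h + f₂ * h ^ 2))
        + (g (y + h) - (g₀ + g₁ * h + g₂ * h ^ 2))| := by congr 1; ring
    _ ≤ _ := abs_add_le _ _
    _ ≤ _ := by rw [add_mul]; exact add_le_add (hf h) (hg h)

/-- Convolving a function bounded by `d` with a normal law of variance `t` gives a function whose
Taylor remainder is of order `d / t ^ (3/2)`: the translation is moved onto the normal density. -/
lemma exists_hasCubicRemainder_integral_gaussianReal :
    ∃ c : ℝ, 0 < c ∧ ∀ (D : ℝ → ℝ) (d : ℝ) (t : NNReal), Measurable D → (∀ x, |D x| ≤ d) →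
      t ≠ 0 → HasCubicRemainder (fun y => ∫ u, D (y - u) ∂gaussianReal 0 t) (c * d / √t ^ 3) := by
  obtain ⟨c, hc, hcb⟩ := exists_integral_abs_gaussianTaylorError_le
  refine ⟨c, hc, fun D d t hD hd ht y => ?_⟩
  set φ := gaussianPDFReal 0 1 with hφ
  have ht0 : 0 < (t : ℝ) := NNReal.coe_pos.2 (pos_iff_ne_zero.2 ht)
  set s := √t with hs
  have hs0 : 0 < s := Real.sqrt_pos.2 ht0
  have hmap : gaussianReal 0 t = (gaussianReal 0 1).map (fun u => -s * u) := by
    rw [gaussianReal_map_const_mul, mul_zero]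
    congr 1
    ext; simp [hs, Real.sq_sqrt ht0.le]
  have hint : ∀ z, ∫ u, D (z - u) ∂gaussianReal 0 t = ∫ u, φ u * D (z + s * u) := by
    intro z
    have hDz : Measurable fun u => D (z - u) := hD.comp (by fun_prop)
    rw [hmap, integral_map (by fun_prop) hDz.aestronglyMeasurable,
      integral_gaussianReal_eq_integral_smul one_ne_zero]
    simp [hφ]
  have hD' : ∀ a, Measurable fun u => D (a + s * u) := fun a => hD.comp (by fun_prop)
  have hbdd : ∀ {g : ℝ → ℝ}, Integrable g → Integrable fun u => g u * D (y + s * u) :=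
    fun hg => hg.mul_bdd (c := d) (hD' y).aestronglyMeasurable
      (Filter.Eventually.of_forall fun u => hd _)
  have i0 := hbdd (integrable_pow_mul_gaussianPDFReal 0)
  have i1 := hbdd (integrable_pow_mul_gaussianPDFReal 1)
  have i2 := hbdd (integrable_pow_mul_gaussianPDFReal 2)
  set m0 := ∫ u, φ u * u ^ 0 * D (y + s * u)
  set m1 := ∫ u, φ u * u ^ 1 * D (y + s * u)
  set m2 := ∫ u, φ u * u ^ 2 * D (y + s * u)
  refine ⟨m0, m1 / s, (m2 - m0) / 2 / s ^ 2, fun k => ?_⟩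
  set h := k / s with hh
  have hk : k = s * h := by rw [hh]; field_simp
  have e1 : ∫ u, φ u * D (y + k + s * u) = ∫ u, φ (u - h) * D (y + s * u) := by
    rw [← integral_sub_right_eq_self _ h]
    congr 1; ext u; congr 2; rw [hk]; ring
  have e2 : m0 + m1 / s * k + (m2 - m0) / 2 / s ^ 2 * k ^ 2 =
      ∫ u, φ u * (1 + u * h + (u ^ 2 - 1) * h ^ 2 / 2) * D (y + s * u) := by
    have : ∀ u, φ u * (1 + u * h + (u ^ 2 - 1) * h ^ 2 / 2) * D (y + s * u) =
        (1 - h ^ 2 / 2) * (φ u * u ^ 0 * D (y + s * u)) + h * (φ u * u ^ 1 * D (y + s * u))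
          + h ^ 2 / 2 * (φ u * u ^ 2 * D (y + s * u)) := fun u => by ring
    simp_rw [this]
    rw [integral_add ((i0.const_mul _).fun_add (i1.const_mul _)) (i2.const_mul _),
      integral_add (i0.const_mul _) (i1.const_mul _), integral_const_mul, integral_const_mul,
      integral_const_mul, hk]
    change _ = (1 - h ^ 2 / 2) * m0 + h * m1 + h ^ 2 / 2 * m2
    field_simp; ring
  have i3 : Integrable fun u => φ (u - h) * D (y + s * u) :=
    hbdd ((integrable_gaussianPDFReal 0 1).comp_sub_right h)
  have i4 : Integrable fun u =>
      φ u * (1 + u * h + (u ^ 2 - 1) * h ^ 2 / 2) * D (y + s * u) := by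
    refine (i3.sub (hbdd (integrable_gaussianTaylorError h))).congr (ae_of_all _ fun u => ?_)
    simp only [Pi.sub_apply, gaussianTaylorError, hφ]
    ring
  beta_reduce
  rw [hint, e1, e2, ← integral_sub i3 i4]
  have hd0 : 0 ≤ d := (abs_nonneg _).trans (hd 0)
  calc _ ≤ ∫ u, |φ (u - h) * D (y + s * u)
          - φ u * (1 + u * h + (u ^ 2 - 1) * h ^ 2 / 2) * D (y + s * u)| := abs_integral_le_integral_abs
    _ ≤ ∫ u, d * |gaussianTaylorError h u| := by
      refine integral_mono (i3.sub i4).abs ((integrable_gaussianTaylorError h).abs.const_mul _)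
        fun u => ?_
      simp only
      rw [← sub_mul, abs_mul, mul_comm]
      exact mul_le_mul_of_nonneg_right (hd _) (abs_nonneg _)
    _ ≤ d * (c * |h| ^ 3) := by
      rw [integral_const_mul]; exact mul_le_mul_of_nonneg_left (hcb h) hd0
    _ = _ := by rw [hh, abs_div, abs_of_pos hs0]; field_simp

/-- Two laws with the same first two moments integrate a translate of `f` to the same value, up to
the Taylor remainder of `f`. -/
lemma HasCubicRemainder.abs_integral_sub_le {f : ℝ → ℝ} {M : ℝ} (hf : HasCubicRemainder f M)
    (hfm : Measurable f) {μ ν : Measure ℝ} [IsProbabilityMeasure μ]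
    [IsProbabilityMeasure ν] (hμ : Integrable (fun x => |x| ^ 3) μ)
    (hν : Integrable (fun x => |x| ^ 3) ν) (h1 : ∫ x, x ∂μ = ∫ x, x ∂ν)
    (h2 : ∫ x, x ^ 2 ∂μ = ∫ x, x ^ 2 ∂ν) (z : ℝ) :
    |∫ x, f (z - x) ∂μ - ∫ x, f (z - x) ∂ν| ≤
      M * (∫ x, |x| ^ 3 ∂μ + ∫ x, |x| ^ 3 ∂ν) := by
  obtain ⟨f₀, f₁, f₂, hf⟩ := hf z
  have key : ∀ (κ : Measure ℝ) [IsProbabilityMeasure κ], Integrable (fun x => |x| ^ 3) κ →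
      |∫ x, f (z - x) ∂κ - (f₀ - f₁ * ∫ x, x ∂κ + f₂ * ∫ x, x ^ 2 ∂κ)|
        ≤ M * ∫ x, |x| ^ 3 ∂κ := by
    intro κ _ hκ
    have hL : MemLp (fun x : ℝ => x) 3 κ :=
      (integrable_norm_rpow_iff (by fun_prop) (by simp) (by simp)).1 (by simpa using hκ)
    have j1 : Integrable (fun x : ℝ => x) κ := hL.integrable (by norm_num)
    have j2 : Integrable (fun x : ℝ => x ^ 2) κ :=
      (hL.mono_exponent (by norm_num : (2 : ENNReal) ≤ 3)).integrable_sq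
    have j0 : Integrable (fun x => f₀ - f₁ * x) κ := (integrable_const _).sub (j1.const_mul _)
    have jp : Integrable (fun x => f₀ - f₁ * x + f₂ * x ^ 2) κ := j0.add (j2.const_mul _)
    have hb : ∀ x, |f (z - x) - (f₀ - f₁ * x + f₂ * x ^ 2)| ≤ M * |x| ^ 3 := fun x => by
      have := hf (-x)
      simpa [← sub_eq_add_neg] using this
    have jr : Integrable (fun x => f (z - x) - (f₀ - f₁ * x + f₂ * x ^ 2)) κ := by
      refine (hκ.const_mul M).mono' ?_ (Filter.Eventually.of_forall hb)
      exact ((hfm.comp (by fun_prop)).sub (by fun_prop)).aestronglyMeasurable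
    have jf : Integrable (fun x => f (z - x)) κ :=
      (jr.add jp).congr (ae_of_all _ fun x => by simp)
    have e : f₀ - f₁ * ∫ x, x ∂κ + f₂ * ∫ x, x ^ 2 ∂κ = ∫ x, f₀ - f₁ * x + f₂ * x ^ 2 ∂κ := by
      rw [integral_add j0 (j2.const_mul _),
        integral_sub (integrable_const _) (j1.const_mul _), integral_const_mul, integral_const_mul]
      simp
    rw [e, ← integral_sub jf jp]
    calc _ ≤ ∫ x, |f (z - x) - (f₀ - f₁ * x + f₂ * x ^ 2)| ∂κ := abs_integral_le_integral_abs
      _ ≤ ∫ x, M * |x| ^ 3 ∂κ := integral_mono jr.abs (hκ.const_mul M) hb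
      _ = _ := integral_const_mul _ _
  have kμ := key μ hμ
  have kν := key ν hν
  rw [h1, h2] at kμ
  rw [mul_add]
  rw [abs_le] at *
  constructor <;> linarith [kμ.1, kμ.2, kν.1, kν.2]

/-! ### Lindeberg replacement -/

/-- The `k`-fold convolution power of `μ`, the law of a sum of `k` independent variables with
law `μ`. -/
noncomputable def convPow (μ : Measure ℝ) : ℕ → Measure ℝ
  | 0 => Measure.dirac 0
  | k + 1 => convPow μ k ∗ μ

instance isProbabilityMeasure_convPow (μ : Measure ℝ) [IsProbabilityMeasure μ] (k : ℕ) :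
    IsProbabilityMeasure (convPow μ k) := by
  induction k with
  | zero => unfold convPow; infer_instance
  | succ k ih => unfold convPow; infer_instance

lemma gaussianReal_zero_conv (s t : NNReal) :
    gaussianReal 0 s ∗ gaussianReal 0 t = gaussianReal 0 (s + t) := by
  rw [gaussianReal_conv_gaussianReal, add_zero]

lemma integral_sq_gaussianReal : ∫ x, x ^ 2 ∂gaussianReal 0 1 = 1 := by
  have := variance_fun_id_gaussianReal (μ := 0) (v := 1)
  rw [variance_of_integral_eq_zero (by fun_prop) (by simp)] at this
  simpa using this

lemma integrable_abs_pow_gaussianReal (v : NNReal) (k : ℕ) :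
    Integrable (fun x => |x| ^ k) (gaussianReal 0 v) := by
  simpa using (memLp_id_gaussianReal (μ := 0) (v := v) k).integrable_norm_pow'

/-- One Lindeberg replacement: a summand with law `μ` is exchanged for a standard normal one, the
other summands being `k` with law `μ` and a normal one with variance `t`. The distribution function
of the latter is that of a normal law of variance `k + t`, which is smooth at scale `√(k + t)`, plus
the convolution of an error of size `d` with a normal law of variance `t`. -/
lemma exists_abs_cdf_convPow_succ_sub_le :
    ∃ c : ℝ, 0 < c ∧ ∀ (μ : Measure ℝ) [IsProbabilityMeasure μ] (ρ : ℝ),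
      Integrable (fun x => |x| ^ 3) μ → ∫ x, x ∂μ = 0 → ∫ x, x ^ 2 ∂μ = 1 →
      ∫ x, |x| ^ 3 ∂μ ≤ ρ → 1 ≤ ρ → ∀ (k : ℕ) (d : ℝ),
      (∀ x, |cdf (convPow μ k) x - cdf (gaussianReal 0 k) x| ≤ d) →
      ∀ t : NNReal, t ≠ 0 → ∀ z,
      |cdf (convPow μ (k + 1) ∗ gaussianReal 0 t) z
          - cdf (convPow μ k ∗ gaussianReal 0 (t + 1)) z|
        ≤ c * ρ * (1 / √(k + t) ^ 3 + d / √t ^ 3) := by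
  obtain ⟨c, hc, hcb⟩ := exists_hasCubicRemainder_integral_gaussianReal
  set g := ∫ x, |x| ^ 3 ∂gaussianReal 0 1
  have hg : 0 ≤ g := integral_nonneg fun x => by positivity
  refine ⟨c * (1 + g), by positivity, fun μ _ ρ h3 h1 h2 hρ hρ1 k d hd t ht z => ?_⟩
  set A := convPow μ k ∗ gaussianReal 0 t with hA
  have e1 : convPow μ (k + 1) ∗ gaussianReal 0 t = A ∗ μ := by
    rw [hA, convPow, Measure.conv_assoc, Measure.conv_assoc, Measure.conv_comm μ]
  have e2 : convPow μ k ∗ gaussianReal 0 (t + 1) = A ∗ gaussianReal 0 1 := by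
    rw [hA, Measure.conv_assoc, gaussianReal_zero_conv]
  have hd0 : 0 ≤ d := (abs_nonneg _).trans (hd 0)
  have hkt : (k + t : NNReal) ≠ 0 := by positivity
  -- a normal distribution function is the convolution of a step function, bounded by `1`
  have r1 : HasCubicRemainder (fun y => cdf (gaussianReal 0 (k + t)) y) (c * 1 / √(k + t) ^ 3) := by
    have := hcb (Set.indicator (Set.Ici 0) 1) 1 (k + t) (measurable_one.indicator measurableSet_Ici)
      (fun x => by by_cases hx : x ∈ Set.Ici (0 : ℝ) <;> simp [hx]) hkt
    push_cast at this
    convert this using 1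
    ext y
    rw [cdf_eq_real, ← integral_indicator_one measurableSet_Iic]
    congr 1; ext u
    simp [Set.indicator]
  have r2 := hcb (fun x => cdf (convPow μ k) x - cdf (gaussianReal 0 k) x) d t
    ((measurable_cdf _).sub (measurable_cdf _)) hd ht
  have hH : HasCubicRemainder (cdf A) (c * (1 / √(k + t) ^ 3 + d / √t ^ 3)) := by
    convert r1.add r2 using 1
    · ext y
      rw [← cdf_conv_sub_cdf_conv, gaussianReal_zero_conv]
      ring
    · ring
  rw [e1, e2, cdf_conv, cdf_conv]
  have := hH.abs_integral_sub_le (measurable_cdf A) h3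
    (integrable_abs_pow_gaussianReal 1 3) (by rw [h1]; simp) (by rw [h2, integral_sq_gaussianReal]) z
  refine this.trans ?_
  have : ∫ x, |x| ^ 3 ∂μ + g ≤ (1 + g) * ρ := by nlinarith
  calc _ ≤ c * (1 / √(k + t) ^ 3 + d / √t ^ 3) * ((1 + g) * ρ) := by gcongr
    _ = _ := by ring

/-! ### Undoing the smoothing -/

/-- Chebyshev's inequality at two standard deviations. -/
lemma gaussianReal_real_Icc_ge (a : NNReal) (ha : a ≠ 0) :
    3 / 4 ≤ (gaussianReal 0 a).real (Set.Icc (-(2 * √a)) (2 * √a)) := by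
  have ha0 : 0 < (a : ℝ) := NNReal.coe_pos.2 (pos_iff_ne_zero.2 ha)
  have h := meas_ge_le_variance_div_sq (μ := gaussianReal 0 a) (memLp_id_gaussianReal 2)
    (c := 2 * √a) (by positivity)
  rw [variance_id_gaussianReal, mul_pow, Real.sq_sqrt ha0.le] at h
  have h' : (gaussianReal 0 a).real {x : ℝ | 2 * √a ≤ |x|} ≤ 1 / 4 := by
    rw [measureReal_def]
    refine ENNReal.toReal_le_of_le_ofReal (by norm_num) ?_
    convert h using 2
    · simp
    · field_simp; norm_num
  have h2 := measureReal_add_measureReal_compl (μ := gaussianReal 0 a)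
    (s := Set.Icc (-(2 * √a)) (2 * √a)) measurableSet_Icc
  have h3 : (gaussianReal 0 a).real (Set.Icc (-(2 * √a)) (2 * √a))ᶜ
      ≤ (gaussianReal 0 a).real {x : ℝ | 2 * √a ≤ |x|} := by
    refine measureReal_mono fun x hx => ?_
    by_contra hx'
    exact hx (abs_le.1 (not_le.1 hx').le)
  rw [probReal_univ] at h2
  linarith

/-- Undoing a Gaussian smoothing, one-sided: if `D` cannot decrease faster than at rate `m`, a large
value at `z` persists on an interval to the right of `z`, of length four standard deviations, and is
seen by the average of `D` around its midpoint. -/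
lemma le_of_integral_sub_gaussianReal_le {D : ℝ → ℝ} {d m Δ : ℝ} {a : NNReal} (ha : a ≠ 0)
    (hD : Measurable D) (hd : ∀ x, |D x| ≤ d) (hm : 0 ≤ m)
    (hmono : ∀ x y, x ≤ y → D x - m * (y - x) ≤ D y)
    (hΔ0 : 0 ≤ Δ) (hΔ : ∀ y, ∫ u, D (y - u) ∂gaussianReal 0 a ≤ Δ) (z : ℝ) :
    D z ≤ 4 / 3 * Δ + d / 3 + 4 * m * √a := by
  set h := 2 * √a with hh
  set s := Set.Icc (-h) h with hs
  rcases le_total (D z - 2 * m * h + d) 0 with hneg | hpos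
  · have := (abs_nonneg _).trans (hd 0)
    rw [hh] at hneg; linarith
  have hi : Integrable (fun u => D (z + h - u)) (gaussianReal 0 a) :=
    Integrable.of_bound (hD.comp (by fun_prop)).aestronglyMeasurable d
      (ae_of_all _ fun u => hd _)
  have hs' : MeasurableSet s := measurableSet_Icc
  have hlow : ∀ u, s.indicator (fun _ => D z - 2 * m * h + d) u - d ≤ D (z + h - u) := by
    intro u
    by_cases hu : u ∈ s
    · have := hmono z (z + h - u) (by linarith [hu.2])
      rw [Set.indicator_of_mem hu]
      nlinarith [hu.1, hu.2]
    · rw [Set.indicator_of_notMem hu]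
      linarith [(abs_le.1 (hd (z + h - u))).1]
  have hi1 : Integrable (s.indicator fun _ => D z - 2 * m * h + d) (gaussianReal 0 a) :=
    (integrable_const _).indicator hs'
  have := (integral_mono (hi1.sub (integrable_const d)) hi hlow).trans (hΔ _)
  rw [integral_sub' hi1 (integrable_const d), integral_indicator_const _ hs'] at this
  simp only [smul_eq_mul, integral_const, probReal_univ, one_mul] at this
  have hp := gaussianReal_real_Icc_ge a ha
  have : 3 / 4 * (D z - 2 * m * h + d) ≤ Δ + d := by
    have := mul_le_mul_of_nonneg_right hp hpos
    linarith
  rw [hh] at this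
  linarith

/-- Undoing a Gaussian smoothing, two-sided: the one-sided bound applied to `D` and to
`x ↦ -D (-x)`. The term `d / 3` is absorbed by taking suprema. -/
lemma abs_le_of_abs_integral_sub_gaussianReal_le {D : ℝ → ℝ} {d m Δ : ℝ} {a : NNReal} (ha : a ≠ 0)
    (hD : Measurable D) (hd : ∀ x, |D x| ≤ d) (hm : 0 ≤ m)
    (hmono : ∀ x y, x ≤ y → D x - m * (y - x) ≤ D y)
    (hΔ : ∀ y, |∫ u, D (y - u) ∂gaussianReal 0 a| ≤ Δ) (z : ℝ) :
    |D z| ≤ 4 / 3 * Δ + d / 3 + 4 * m * √a := by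
  have hd0 : 0 ≤ d := (abs_nonneg _).trans (hd 0)
  have hΔ0 : 0 ≤ Δ := (abs_nonneg _).trans (hΔ 0)
  have hma : 0 ≤ m * √a := by positivity
  have h1 := le_of_integral_sub_gaussianReal_le ha hD hd hm hmono hΔ0
    (fun y => (le_abs_self _).trans (hΔ y)) z
  have h2 := le_of_integral_sub_gaussianReal_le (D := fun x => -D (-x)) ha
    (hD.comp measurable_neg).neg (fun x => by simpa using hd (-x)) hm
    (fun x y hxy => by have := hmono (-y) (-x) (by linarith); linarith)
    hΔ0 (fun y => by
      refine le_trans (le_of_eq ?_) ((neg_le_abs _).trans (hΔ (-y)))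
      have hsymm : gaussianReal 0 a = (gaussianReal 0 a).map (fun x => -x) := by
        rw [gaussianReal_map_neg, neg_zero]
      have hm' : Measurable fun u => -D (-y - u) := (hD.comp (by fun_prop)).neg
      rw [← integral_neg]
      conv_rhs => rw [hsymm, integral_map (by fun_prop) hm'.aestronglyMeasurable]
      congr 1; ext u; congr 2; ring) (-z)
  simp only [neg_neg] at h2
  rw [abs_le]
  constructor <;> linarith

lemma cdf_gaussianReal_sub_le_of_pdf_le {v : NNReal} (hv : v ≠ 0) {x y B : ℝ} (hxy : x ≤ y)
    (hB : ∀ u ∈ Set.Ioc x y, gaussianPDFReal 0 v u ≤ B) :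
    cdf (gaussianReal 0 v) y - cdf (gaussianReal 0 v) x ≤ B * (y - x) := by
  have e : cdf (gaussianReal 0 v) y - cdf (gaussianReal 0 v) x
      = ∫ u in Set.Ioc x y, gaussianPDFReal 0 v u := by
    rw [cdf_eq_real, cdf_eq_real, ← measureReal_sdiff (Set.Iic_subset_Iic.2 hxy) measurableSet_Iic,
      Set.Iic_sdiff_Iic, measureReal_def, gaussianReal_apply_eq_integral 0 hv,
      ENNReal.toReal_ofReal (integral_nonneg fun u => gaussianPDFReal_nonneg 0 v u)]
  rw [e]
  refine (setIntegral_mono_on (integrable_gaussianPDFReal 0 v).integrableOn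
    (integrableOn_const (C := B) (by simp)) measurableSet_Ioc hB).trans (le_of_eq ?_)
  simp [hxy, mul_comm]

lemma gaussianPDFReal_le_one_div_sqrt (v : NNReal) (u : ℝ) :
    gaussianPDFReal 0 v u ≤ 1 / √v := by
  rw [gaussianPDFReal, Real.sqrt_mul (by positivity), mul_inv, one_div]
  have h1 := inv_sqrt_two_pi_le_one
  have h2 : Real.exp (-(u - 0) ^ 2 / (2 * v)) ≤ 1 := by
    rw [Real.exp_le_one_iff]
    exact div_nonpos_of_nonpos_of_nonneg (by nlinarith [sq_nonneg (u - 0)]) (by positivity)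
  calc _ ≤ 1 * (√v)⁻¹ * 1 := by gcongr
    _ = _ := by ring

/-! ### The Berry–Esseen theorem for convolution powers -/

/-- The summands are dominated by the telescoping differences of `8 / √(j + a)`. -/
lemma sum_one_div_sqrt_pow_three_le {a : ℝ} (ha : 1 ≤ a) (n : ℕ) :
    ∑ j ∈ Finset.range n, 1 / √(j + a) ^ 3 ≤ 8 / √a := by
  suffices h : ∑ j ∈ Finset.range n, 1 / √(j + a) ^ 3 ≤ 8 / √a - 8 / √(n + a) from
    h.trans (sub_le_self _ (by positivity))
  induction n with
  | zero => simp
  | succ n ih =>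
    rw [Finset.sum_range_succ]
    have key : 1 / √(n + a) ^ 3 ≤ 8 / √(n + a) - 8 / √((n + 1 : ℕ) + a) := by
      have hx : 1 ≤ n + a := by linarith [Nat.cast_nonneg (α := ℝ) n]
      have e : ((n + 1 : ℕ) : ℝ) + a = (n + a) + 1 := by push_cast; ring
      rw [e]
      generalize (n : ℝ) + a = x at hx
      set p := √x with hp
      set q := √(x + 1) with hq
      have hp1 : 1 ≤ p := by rw [hp, Real.one_le_sqrt]; exact hx
      have hpq : p ≤ q := Real.sqrt_le_sqrt (by linarith)
      have p2 : p ^ 2 = x := Real.sq_sqrt (by linarith)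
      have q2 : q ^ 2 = x + 1 := Real.sq_sqrt (by linarith)
      have hq2 : q ≤ 2 * p := by nlinarith
      have hd : (q - p) * (q + p) = 1 := by nlinarith
      rw [div_sub_div _ _ (by positivity) (by positivity), div_le_div_iff₀ (by positivity)
        (by positivity)]
      -- `8 p² (q - p) ≥ q` because `q - p = 1 / (q + p) ≥ 1 / (3 p)`
      have : 1 ≤ (q - p) * (3 * p) := by nlinarith
      have : q ≤ 8 * (q - p) * p ^ 2 := by nlinarith
      nlinarith
    linarith

/-- Replacing the `n` summands with law `μ` one after the other. -/
lemma abs_cdf_convPow_conv_sub_le_sum {μ : Measure ℝ} [IsProbabilityMeasure μ] (n : ℕ)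
    (a : NNReal) (z : ℝ) (b : ℕ → ℝ)
    (hb : ∀ k < n, |cdf (convPow μ (k + 1) ∗ gaussianReal 0 (a + (n - 1 - k : ℕ))) z
      - cdf (convPow μ k ∗ gaussianReal 0 (a + (n - 1 - k : ℕ) + 1)) z| ≤ b k) :
    |cdf (convPow μ n ∗ gaussianReal 0 a) z - cdf (gaussianReal 0 n ∗ gaussianReal 0 a) z|
      ≤ ∑ k ∈ Finset.range n, b k := by
  have := Finset.sum_range_sub
    (fun k => cdf (convPow μ k ∗ gaussianReal 0 (a + (n - k : ℕ))) z) n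
  simp only [Nat.sub_self, Nat.sub_zero, Nat.cast_zero, add_zero] at this
  have e0 : convPow μ 0 ∗ gaussianReal 0 (a + n) = gaussianReal 0 n ∗ gaussianReal 0 a := by
    rw [convPow, Measure.dirac_zero_conv, gaussianReal_zero_conv, add_comm]
  rw [e0] at this
  rw [← this]
  refine (Finset.abs_sum_le_sum_abs _ _).trans (Finset.sum_le_sum fun k hk => ?_)
  have hk' := Finset.mem_range.1 hk
  have e1 : n - (k + 1) = n - 1 - k := by omega
  have e2 : a + (n - k : ℕ) = a + (n - 1 - k : ℕ) + 1 := by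
    rw [show n - k = n - 1 - k + 1 by omega, Nat.cast_add_one, add_assoc]
  simpa only [e1, e2] using hb k hk'

/-- The Berry–Esseen theorem, for convolution powers of a centred law with unit variance, by strong
induction on `n`. -/
theorem exists_abs_cdf_convPow_sub_le :
    ∃ C : ℝ, 0 < C ∧ ∀ (μ : Measure ℝ) [IsProbabilityMeasure μ] (ρ : ℝ),
      Integrable (fun x => |x| ^ 3) μ → ∫ x, x ∂μ = 0 → ∫ x, x ^ 2 ∂μ = 1 →
      ∫ x, |x| ^ 3 ∂μ ≤ ρ → 1 ≤ ρ → ∀ n : ℕ, 1 ≤ n → ∀ z,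
      |cdf (convPow μ n) z - cdf (gaussianReal 0 n) z| ≤ C * (ρ / √n) := by
  obtain ⟨c, hc, hcb⟩ := exists_abs_cdf_convPow_succ_sub_le
  -- The smoothing variance is `a = (K ρ)²`. The induction hypothesis re-enters the bound with the
  -- factor `32 c / K`, which this `K` makes at most `1 / 2`; then `C` closes the induction.
  set K := 64 * c + 1 with hK
  set C := 2 * (8 * c + 6 * K) with hC
  have hK0 : 0 < K := by positivity
  have hC0 : 0 < C := by positivity
  refine ⟨C, hC0, fun μ _ ρ h3 h1 h2 hρ hρ1 n => ?_⟩
  have hρ0 : 0 < ρ := by linarith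
  induction n using Nat.strong_induction_on with
  | _ n ih =>
  intro hn
  have hn1 : (1 : ℝ) ≤ n := by exact_mod_cast hn
  have hn0 : (0 : ℝ) < n := by linarith
  set r := √(n : ℝ) with hr
  have hr0 : 0 < r := Real.sqrt_pos.2 hn0
  have hr2 : r ^ 2 = n := Real.sq_sqrt hn0.le
  set a : NNReal := (Real.toNNReal (K * ρ)) ^ 2 with ha
  have hKρ : 1 ≤ K * ρ := by nlinarith
  have haR : (a : ℝ) = (K * ρ) ^ 2 := by
    rw [ha, NNReal.coe_pow, Real.coe_toNNReal _ (by positivity)]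
  have hsa : √(a : ℝ) = K * ρ := by rw [haR, Real.sqrt_sq (by positivity)]
  have ha1 : (1 : ℝ) ≤ a := by rw [haR]; exact one_le_pow₀ hKρ
  have ha0 : a ≠ 0 := by rintro h; rw [h] at ha1; norm_num at ha1
  set D : ℝ → ℝ := fun z => cdf (convPow μ n) z - cdf (gaussianReal 0 n) z with hD
  set Δ := c * ρ / r * (4 + 16 * C / K) with hΔ
  -- the smoothed laws are close, by Lindeberg replacements
  have hsm : ∀ z, |cdf (convPow μ n ∗ gaussianReal 0 a) z
      - cdf (gaussianReal 0 n ∗ gaussianReal 0 a) z| ≤ Δ := by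
    intro z
    have hstep : ∀ k < n, |cdf (convPow μ (k + 1) ∗ gaussianReal 0 (a + (n - 1 - k : ℕ))) z
        - cdf (convPow μ k ∗ gaussianReal 0 (a + (n - 1 - k : ℕ) + 1)) z|
        ≤ c * ρ * (4 / r ^ 3 + 2 * C * ρ / r * (1 / √((n - 1 - k : ℕ) + a) ^ 3)) := by
      intro k hk
      have ht : a + (n - 1 - k : ℕ) ≠ 0 := by positivity
      have hcast : ((n - 1 - k : ℕ) : ℝ) = n - 1 - k := by
        rw [Nat.cast_sub (by omega), Nat.cast_sub hn, Nat.cast_one]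
      have htR : ((a + (n - 1 - k : ℕ) : NNReal) : ℝ) = (n - 1 - k : ℕ) + a := by
        rw [NNReal.coe_add, NNReal.coe_natCast, add_comm]
      have hfirst : 1 / √(k + (a + (n - 1 - k : ℕ) : NNReal)) ^ 3 ≤ 1 / r ^ 3 := by
        rw [htR, hcast]
        have : r ≤ √(k + (n - 1 - k + a)) := Real.sqrt_le_sqrt (by linarith)
        gcongr
      -- for `2 k < n` the remaining normal part has variance at least `n / 2` and the trivial bound
      -- for the error suffices; otherwise the induction hypothesis is of order `ρ / √n`
      rcases lt_or_ge (2 * k) n with hkn | hkn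
      · refine (hcb μ ρ h3 h1 h2 hρ hρ1 k 1 (fun x => abs_cdf_sub_cdf_le_one _ _ x) _ ht z).trans ?_
        have hkn' : (2 : ℝ) * k < n := by exact_mod_cast hkn
        have hsecond : 1 / √(a + (n - 1 - k : ℕ) : NNReal) ^ 3 ≤ 3 / r ^ 3 := by
          rw [htR, hcast]
          have hx : (n : ℝ) / 2 ≤ n - 1 - k + a := by linarith
          set s := √((n : ℝ) - 1 - k + a)
          have hs2 : s ^ 2 = n - 1 - k + a := Real.sq_sqrt (by linarith)
          have hs0 : 0 < s := Real.sqrt_pos.2 (by linarith)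
          have hrs : r ≤ 1.42 * s := by
            refine Real.sqrt_le_iff.2 ⟨by positivity, ?_⟩
            rw [mul_pow, hs2]; linarith
          rw [div_le_div_iff₀ (by positivity) (by positivity), one_mul]
          calc r ^ 3 ≤ (1.42 * s) ^ 3 := by gcongr
            _ = 1.42 ^ 3 * s ^ 3 := mul_pow _ _ _
            _ ≤ 3 * s ^ 3 := by gcongr; norm_num
        have hnn : 0 ≤ 2 * C * ρ / r * (1 / √((n - 1 - k : ℕ) + a : ℝ) ^ 3) := by positivity
        have e : 4 / r ^ 3 = 1 / r ^ 3 + 3 / r ^ 3 := by ring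
        rw [e]
        refine mul_le_mul_of_nonneg_left ?_ (by positivity)
        linarith
      · have hk1 : 1 ≤ k := by omega
        have hkn' : (n : ℝ) ≤ 2 * k := by exact_mod_cast hkn
        have hd : ∀ x, |cdf (convPow μ k) x - cdf (gaussianReal 0 k) x| ≤ 2 * C * ρ / r := by
          intro x
          refine (ih k hk hk1 x).trans ?_
          have hk0 : 0 < √(k : ℝ) := Real.sqrt_pos.2 (by exact_mod_cast hk1)
          have : r ≤ 2 * √(k : ℝ) := by
            refine Real.sqrt_le_iff.2 ⟨by positivity, ?_⟩
            rw [mul_pow, Real.sq_sqrt (by positivity)]; linarith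
          rw [← mul_div_assoc, div_le_div_iff₀ hk0 hr0]
          have := mul_le_mul_of_nonneg_left this (by positivity : 0 ≤ C * ρ)
          linarith
        refine (hcb μ ρ h3 h1 h2 hρ hρ1 k _ hd _ ht z).trans ?_
        rw [htR] at hfirst ⊢
        have h4 : 1 / r ^ 3 ≤ 4 / r ^ 3 := by gcongr; norm_num
        rw [← mul_one_div (2 * C * ρ / r)]
        exact mul_le_mul_of_nonneg_left (add_le_add (hfirst.trans h4) le_rfl) (by positivity)
    refine (abs_cdf_convPow_conv_sub_le_sum n a z _ hstep).trans ?_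
    rw [← Finset.mul_sum, Finset.sum_add_distrib, ← Finset.mul_sum,
      Finset.sum_range_reflect (fun j => 1 / √((j : ℝ) + a) ^ 3) n]
    have := sum_one_div_sqrt_pow_three_le ha1 n
    rw [hsa] at this
    simp only [Finset.sum_const, Finset.card_range, nsmul_eq_mul]
    calc _ ≤ c * ρ * (n * (4 / r ^ 3) + 2 * C * ρ / r * (8 / (K * ρ))) := by gcongr
      _ = Δ := by rw [hΔ, ← hr2]; field_simp; ring
  -- undo the smoothing
  have hDm : Measurable D := (measurable_cdf _).sub (measurable_cdf _)
  have hn' : (n : NNReal) ≠ 0 := by positivity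
  have hbdd : BddAbove (Set.range fun z => |D z|) :=
    ⟨1, by rintro _ ⟨z, rfl⟩; exact abs_cdf_sub_cdf_le_one _ _ z⟩
  set d := ⨆ z, |D z| with hd
  have hDd : ∀ z, |D z| ≤ d := fun z => le_ciSup hbdd z
  have hsup : d ≤ 4 / 3 * Δ + d / 3 + 4 * (1 / r) * (K * ρ) := by
    refine ciSup_le fun z => ?_
    rw [← hsa]
    refine abs_le_of_abs_integral_sub_gaussianReal_le ha0 hDm hDd (by positivity) ?_ ?_ z
    · intro x y hxy
      have h1 := monotone_cdf (convPow μ n) hxy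
      have h2 := cdf_gaussianReal_sub_le_of_pdf_le hn' hxy
        fun u _ => gaussianPDFReal_le_one_div_sqrt n u
      rw [NNReal.coe_natCast, ← hr] at h2
      simp only [hD]
      linarith
    · intro y
      have := hsm y
      rwa [cdf_conv_sub_cdf_conv] at this
  intro z
  have hfin : d ≤ (8 * c + 6 * K + 32 * c * (C / K)) * (ρ / r) := by
    have e : (8 * c + 6 * K + 32 * c * (C / K)) * (ρ / r) = 2 * Δ + 6 * (1 / r) * (K * ρ) := by
      rw [hΔ]; field_simp; ring
    rw [e]; linarith
  refine (hDd z).trans (hfin.trans ?_)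
  have : 32 * c * (C / K) ≤ C / 2 := by
    rw [← mul_div_assoc, div_le_div_iff₀ hK0 two_pos]
    nlinarith
  gcongr
  linarith

/-! ### The Berry–Esseen theorem for random variables -/

lemma cdf_gaussianReal_eq {v : NNReal} (hv : v ≠ 0) (y : ℝ) :
    cdf (gaussianReal 0 v) y = cdf (gaussianReal 0 1) (y / √v) := by
  have hv0 : 0 < (v : ℝ) := NNReal.coe_pos.2 (pos_iff_ne_zero.2 hv)
  have hs0 : 0 < √(v : ℝ) := Real.sqrt_pos.2 hv0
  have hmap : gaussianReal 0 v = (gaussianReal 0 1).map (fun u => √v * u) := by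
    rw [gaussianReal_map_const_mul, mul_zero]
    congr 1
    ext; simp [Real.sq_sqrt hv0.le]
  rw [cdf_eq_real, cdf_eq_real, hmap, map_measureReal_apply (by fun_prop) measurableSet_Iic]
  congr 1
  ext u
  simp only [Set.mem_preimage, Set.mem_Iic]
  rw [le_div_iff₀ hs0, mul_comm]

/-- Between `x` and `l * x` the normal density is at most `2 / |x|`, as `|u| φ(u) ≤ 1`. -/
lemma abs_cdf_gaussianReal_mul_sub_le {l : ℝ} (hl : 1 / 2 ≤ l) (x : ℝ) :
    |cdf (gaussianReal 0 1) (l * x) - cdf (gaussianReal 0 1) x| ≤ 2 * |l - 1| := by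
  rcases eq_or_ne x 0 with rfl | hx
  · simp
  have hx0 : 0 < |x| := abs_pos.2 hx
  have hpdf : ∀ u, |x| / 2 ≤ |u| → gaussianPDFReal 0 1 u ≤ 2 / |x| := by
    intro u hu
    have hu0 : 0 < |u| := by linarith
    have h1 : (√(2 * Real.pi * (1 : NNReal)))⁻¹ ≤ 1 := by
      rw [NNReal.coe_one, mul_one]; exact inv_sqrt_two_pi_le_one
    have h2 : Real.exp (-(u - 0) ^ 2 / (2 * (1 : NNReal))) ≤ 1 / |u| := by
      rw [NNReal.coe_one, sub_zero, mul_one, neg_div, Real.exp_neg, ← one_div]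
      have := Real.add_one_le_exp (u ^ 2 / 2)
      refine one_div_le_one_div_of_le hu0 ?_
      nlinarith [sq_nonneg (|u| - 1), sq_abs u]
    calc gaussianPDFReal 0 1 u ≤ 1 * (1 / |u|) := by rw [gaussianPDFReal]; gcongr
      _ = 1 / |u| := one_mul _
      _ ≤ 1 / (|x| / 2) := by gcongr
      _ = _ := by field_simp
  rcases le_total (l * x) x with h | h
  · have := cdf_gaussianReal_sub_le_of_pdf_le one_ne_zero h (B := 2 / |x|) fun u hu => hpdf u (by
      rcases lt_or_gt_of_ne hx with hx' | hx'
      · rw [abs_of_neg hx', abs_of_neg (by linarith [hu.2])]; linarith [hu.2]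
      · have := mul_le_mul_of_nonneg_right hl hx'.le
        rw [abs_of_pos hx', abs_of_pos (by linarith [hu.1])]; linarith [hu.1])
    rw [abs_sub_comm, abs_of_nonneg (sub_nonneg.2 (monotone_cdf _ h))]
    refine this.trans (le_of_eq ?_)
    rw [← abs_of_nonneg (sub_nonneg.2 h), show x - l * x = -((l - 1) * x) by ring, abs_neg, abs_mul]
    field_simp
  · have := cdf_gaussianReal_sub_le_of_pdf_le one_ne_zero h (B := 2 / |x|) fun u hu => hpdf u (by
      rcases lt_or_gt_of_ne hx with hx' | hx'
      · have := mul_le_mul_of_nonpos_right hl hx'.le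
        rw [abs_of_neg hx', abs_of_neg (by linarith [hu.2])]; linarith [hu.2]
      · rw [abs_of_pos hx', abs_of_pos (by linarith [hu.1])]; linarith [hu.1])
    rw [abs_of_nonneg (sub_nonneg.2 (monotone_cdf _ h))]
    refine this.trans (le_of_eq ?_)
    rw [← abs_of_nonneg (sub_nonneg.2 h), show l * x - x = (l - 1) * x by ring, abs_mul]
    field_simp

section Moments

variable {Ω : Type u} [MeasurableSpace Ω] {P : Measure Ω} [IsProbabilityMeasure P]

lemma memLp_two_of_integrable_abs_pow {X : Ω → ℝ} (hX : Measurable X)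
    (h3 : Integrable (fun ω => |X ω| ^ 3) P) : MemLp X 2 P :=
  MemLp.mono_exponent (q := 3)
    ((integrable_norm_rpow_iff hX.aestronglyMeasurable (by simp) (by simp)).1 (by simpa using h3))
    (by norm_num)

/-- Jensen's inequality for `t ↦ t ^ 3`. -/
lemma abs_integral_pow_three_le {X : Ω → ℝ} (hX : Measurable X)
    (h3 : Integrable (fun ω => |X ω| ^ 3) P) : |∫ ω, X ω ∂P| ^ 3 ≤ ∫ ω, |X ω| ^ 3 ∂P := by
  have hi := (memLp_two_of_integrable_abs_pow hX h3).integrable (by norm_num)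
  have h : |∫ ω, X ω ∂P| ≤ ∫ ω, |X ω| ∂P := abs_integral_le_integral_abs
  set m := |∫ ω, X ω ∂P| with hm
  have hm0 : 0 ≤ m := abs_nonneg _
  -- the tangent to `t ↦ t ^ 3` at `m`
  have hp : ∀ ω, 3 * m ^ 2 * |X ω| - 2 * m ^ 3 ≤ |X ω| ^ 3 := fun ω => by
    have h1 : 0 ≤ |X ω| := abs_nonneg _
    nlinarith [mul_nonneg (sq_nonneg (|X ω| - m)) (by linarith : 0 ≤ |X ω| + 2 * m)]
  have := integral_mono ((hi.abs.const_mul (3 * m ^ 2)).sub (integrable_const (2 * m ^ 3))) h3 hp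
  rw [integral_sub' (hi.abs.const_mul _) (integrable_const _), integral_const_mul] at this
  simp only [integral_const, probReal_univ, one_smul] at this
  nlinarith [mul_le_mul_of_nonneg_left h (by positivity : 0 ≤ 3 * m ^ 2)]

/-- The standardised variable has mean zero, unit variance, and a third absolute moment between
`1` and `8 * 𝔼|X|³ / s³`. -/
lemma standardized_moments {X : Ω → ℝ} (hX : Measurable X)
    (h3 : Integrable (fun ω => |X ω| ^ 3) P) {m s : ℝ} (hm : m = ∫ ω, X ω ∂P)
    (hs : s ^ 2 = Var[X; P]) (hs0 : 0 < s) :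
    Integrable (fun ω => |(X ω - m) / s| ^ 3) P ∧ ∫ ω, (X ω - m) / s ∂P = 0 ∧
      ∫ ω, ((X ω - m) / s) ^ 2 ∂P = 1 ∧
      ∫ ω, |(X ω - m) / s| ^ 3 ∂P ≤ 8 * ((∫ ω, |X ω| ^ 3 ∂P) / s ^ 3) ∧
      1 ≤ 8 * ((∫ ω, |X ω| ^ 3 ∂P) / s ^ 3) := by
  have hL2 := memLp_two_of_integrable_abs_pow hX h3
  have hi := hL2.integrable (by norm_num)
  have hZm : Measurable fun ω => (X ω - m) / s := by fun_prop
  have hm3 : |m| ^ 3 ≤ ∫ ω, |X ω| ^ 3 ∂P := by rw [hm]; exact abs_integral_pow_three_le hX h3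
  have hp : ∀ ω, |(X ω - m) / s| ^ 3 ≤ 4 / s ^ 3 * (|X ω| ^ 3 + |m| ^ 3) := fun ω => by
    rw [abs_div, abs_of_pos hs0, div_pow, div_mul_eq_mul_div]
    refine div_le_div_of_nonneg_right ?_ (by positivity)
    have h1 : |X ω - m| ≤ |X ω| + |m| := abs_sub _ _
    have h2 : 0 ≤ |X ω| := abs_nonneg _
    have h4 : 0 ≤ |m| := abs_nonneg _
    refine (pow_le_pow_left₀ (abs_nonneg _) h1 3).trans ?_
    nlinarith [mul_nonneg (sq_nonneg (|X ω| - |m|)) (by linarith : 0 ≤ |X ω| + |m|)]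
  have hpi : Integrable (fun ω => 4 / s ^ 3 * (|X ω| ^ 3 + |m| ^ 3)) P :=
    (h3.add (integrable_const _)).const_mul _
  have hZ3 : Integrable (fun ω => |(X ω - m) / s| ^ 3) P := by
    refine hpi.mono' (by fun_prop) (ae_of_all _ fun ω => ?_)
    rw [Real.norm_eq_abs, abs_of_nonneg (by positivity)]
    exact hp ω
  have hZ2 : ∫ ω, ((X ω - m) / s) ^ 2 ∂P = 1 := by
    simp_rw [div_pow]
    rw [integral_div, hm, ← variance_eq_integral hX.aemeasurable, ← hs]
    field_simp
  have hle : ∫ ω, |(X ω - m) / s| ^ 3 ∂P ≤ 8 * ((∫ ω, |X ω| ^ 3 ∂P) / s ^ 3) := by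
    refine (integral_mono hZ3 hpi hp).trans ?_
    rw [integral_const_mul, integral_add h3 (integrable_const _)]
    simp only [integral_const, probReal_univ, one_smul]
    calc _ ≤ 4 / s ^ 3 * (∫ ω, |X ω| ^ 3 ∂P + ∫ ω, |X ω| ^ 3 ∂P) := by gcongr
      _ = _ := by ring
  have hge : 1 ≤ ∫ ω, |(X ω - m) / s| ^ 3 ∂P := by
    have hZi := (memLp_two_of_integrable_abs_pow hZm hZ3).integrable_sq
    -- `t ^ 3` lies above its tangent in `t ^ 2` at `t = 1`
    have hq : ∀ ω, 3 / 2 * ((X ω - m) / s) ^ 2 - 1 / 2 ≤ |(X ω - m) / s| ^ 3 := fun ω => by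
      rw [← sq_abs]
      generalize |(X ω - m) / s| = t, abs_nonneg ((X ω - m) / s) = ht
      nlinarith [mul_nonneg (sq_nonneg (t - 1)) (by linarith : 0 ≤ 2 * t + 1)]
    have := integral_mono ((hZi.const_mul (3 / 2)).sub (integrable_const (1 / 2))) hZ3 hq
    rw [integral_sub' (hZi.const_mul _) (integrable_const _), integral_const_mul, hZ2] at this
    simp only [integral_const, probReal_univ, one_smul] at this
    linarith
  refine ⟨hZ3, ?_, hZ2, hle, hge.trans hle⟩
  rw [integral_div, integral_sub hi (integrable_const _), ← hm]
  simp

lemma map_sum_range_eq_convPow {Z : ℕ → Ω → ℝ} (hZ : ∀ i, Measurable (Z i)) (hind : iIndepFun Z P)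
    (hid : ∀ i, IdentDistrib (Z i) (Z 0) P P) (n : ℕ) :
    P.map (fun ω => ∑ i ∈ Finset.range n, Z i ω) = convPow (P.map (Z 0)) n := by
  induction n with
  | zero => simp [convPow, Measure.map_const]
  | succ n ih =>
    have hi := hind.indepFun_finsetSum_of_notMem hZ (Finset.notMem_range_self (n := n))
    have e : (fun ω => ∑ i ∈ Finset.range (n + 1), Z i ω) = ∑ j ∈ Finset.range n, Z j + Z n := by
      ext ω; simp [Finset.sum_range_succ]
    have e' : (∑ j ∈ Finset.range n, Z j) = fun ω => ∑ i ∈ Finset.range n, Z i ω := by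
      ext ω; simp
    have hm : Measurable (∑ j ∈ Finset.range n, Z j) := by
      rw [e']; exact Finset.measurable_sum _ fun i _ => hZ i
    rw [e, hi.map_add_eq_map_conv_map hm (hZ n), (hid n).map_eq, e', ih, convPow]

end Moments

/-- The Berry–Esseen theorem for sums of independent identically distributed variables. -/
theorem berry_esseen :
    ∃ C : ℝ, 0 < C ∧ ∀ (Ω : Type u) [MeasurableSpace Ω] (P : Measure Ω) [IsProbabilityMeasure P]
      (X : ℕ → Ω → ℝ) (m s : ℝ), (∀ i, Measurable (X i)) → iIndepFun X P →
      (∀ i, IdentDistrib (X i) (X 0) P P) → Integrable (fun ω => |X 0 ω| ^ 3) P →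
      m = ∫ ω, X 0 ω ∂P → s ^ 2 = Var[X 0; P] → 0 < s → ∀ n : ℕ, 1 ≤ n → ∀ w : ℝ,
      |P.real {ω | ∑ i ∈ Finset.range n, X i ω ≤ w}
          - cdf (gaussianReal 0 1) ((w - n * m) / (s * √n))|
        ≤ C * ((∫ ω, |X 0 ω| ^ 3 ∂P) / s ^ 3 / √n) := by
  obtain ⟨C, hC, hCb⟩ := exists_abs_cdf_convPow_sub_le
  refine ⟨8 * C, by positivity, fun Ω _ P _ X m s hX hind hid h3 hm hs hs0 n hn w => ?_⟩
  obtain ⟨hZ3, hZ1, hZ2, hle, hge⟩ := standardized_moments (hX 0) h3 hm hs hs0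
  have hZm : ∀ i, Measurable fun ω => (X i ω - m) / s := fun i => by fun_prop
  have hg : Measurable fun x : ℝ => (x - m) / s := by fun_prop
  have hsum := map_sum_range_eq_convPow hZm (hind.comp (fun _ => fun x => (x - m) / s) fun _ => hg)
    (fun i => (hid i).comp hg) n
  have : IsProbabilityMeasure (P.map fun ω => (X 0 ω - m) / s) :=
    Measure.isProbabilityMeasure_map (hZm 0).aemeasurable
  have key := hCb (P.map fun ω => (X 0 ω - m) / s) _
    ((integrable_map_measure (by fun_prop) (hZm 0).aemeasurable).2 hZ3)
    (by rw [integral_map (hZm 0).aemeasurable (by fun_prop)]; exact hZ1)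
    (by rw [integral_map (hZm 0).aemeasurable (by fun_prop)]; exact hZ2)
    (by rw [integral_map (hZm 0).aemeasurable (by fun_prop)]; exact hle) hge n hn ((w - n * m) / s)
  have hn' : (n : NNReal) ≠ 0 := by positivity
  rw [cdf_gaussianReal_eq hn', cdf_eq_real, ← hsum, map_measureReal_apply
    (Finset.measurable_sum _ fun i _ => hZm i) measurableSet_Iic, NNReal.coe_natCast,
    div_div] at key
  convert key using 1
  · congr 3
    ext ω
    simp only [Set.mem_ofPred_eq, Set.mem_preimage, Set.mem_Iic]
    rw [← Finset.sum_div, div_le_div_iff_of_pos_right hs0, Finset.sum_sub_distrib]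
    simp
  · ring

/-! ### Random sums -/

/-- Conditioning on the number of summands. -/
lemma measureReal_random_sum_le {Ω : Type u} [MeasurableSpace Ω] {P : Measure Ω}
    [IsProbabilityMeasure P] {X : ℕ → Ω → ℝ} {N : Ω → ℕ} (hX : ∀ i, Measurable (X i))
    (hN : Measurable N) (hXN : IndepFun (fun ω i => X i ω) N P) (w : ℝ) :
    P.real {ω | ∑ i ∈ Finset.range (N ω), X i ω ≤ w}
      = ∫ ω, P.real {ω' | ∑ i ∈ Finset.range (N ω), X i ω' ≤ w} ∂P := by
  have hξ : Measurable fun ω i => X i ω := measurable_pi_lambda _ hX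
  set S : Set ((ℕ → ℝ) × ℕ) := {p | ∑ i ∈ Finset.range p.2, p.1 i ≤ w} with hS
  have hSm : MeasurableSet S := by
    refine measurableSet_le ?_ measurable_const
    refine measurable_from_prod_countable_left fun m => ?_
    change Measurable fun x : ℕ → ℝ => ∑ i ∈ Finset.range m, x i
    exact Finset.measurable_sum _ fun i _ => measurable_pi_apply i
  have hmap := (indepFun_iff_map_prod_eq_prod_map_map hξ.aemeasurable hN.aemeasurable).1 hXN
  have h1 : P {ω | ∑ i ∈ Finset.range (N ω), X i ω ≤ w}
      = ∫⁻ ω, P {ω' | ∑ i ∈ Finset.range (N ω), X i ω' ≤ w} ∂P := by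
    calc _ = P.map (fun ω => ((fun i => X i ω), N ω)) S := by
          rw [Measure.map_apply (hξ.prodMk hN) hSm]; rfl
      _ = ∫⁻ m, P.map (fun ω i => X i ω) ((fun x => (x, m)) ⁻¹' S) ∂P.map N := by
          rw [hmap, Measure.prod_apply_symm hSm]
      _ = ∫⁻ ω, P.map (fun ω i => X i ω) ((fun x => (x, N ω)) ⁻¹' S) ∂P :=
          lintegral_map (Measurable.of_discrete) hN
      _ = _ := by
          refine lintegral_congr fun ω => ?_
          rw [Measure.map_apply hξ (measurable_prodMk_right hSm)]; rfl
  have hF : Measurable fun m : ℕ => P.real {ω' | ∑ i ∈ Finset.range m, X i ω' ≤ w} :=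
    Measurable.of_discrete
  rw [integral_eq_lintegral_of_nonneg_ae (ae_of_all _ fun ω => measureReal_nonneg)
    (hF.comp hN).aestronglyMeasurable, measureReal_def, h1]
  congr 1
  refine lintegral_congr fun ω => ?_
  rw [measureReal_def, ENNReal.ofReal_toReal (measure_ne_top _ _)]

/-- The mean absolute deviation of a sum is at most its standard deviation. -/
lemma integral_abs_sum_sub_le {Ω : Type u} [MeasurableSpace Ω] {P : Measure Ω}
    [IsProbabilityMeasure P] {Y : ℕ → Ω → ℝ} {ν τ : ℝ} (hind : iIndepFun Y P)
    (hid : ∀ i, IdentDistrib (Y i) (Y 0) P P) (hL : MemLp (Y 0) 2 P)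
    (hν : ν = ∫ ω, Y 0 ω ∂P) (hτ : τ ^ 2 = Var[Y 0; P]) (hτ0 : 0 < τ) {n : ℕ} (hn : 1 ≤ n) :
    Integrable (fun ω => |∑ i ∈ Finset.range n, Y i ω - n * ν|) P ∧
      ∫ ω, |∑ i ∈ Finset.range n, Y i ω - n * ν| ∂P ≤ τ * √n := by
  have hLi : ∀ i, MemLp (Y i) 2 P := fun i => (hid i).symm.memLp_snd hL
  have hS : MemLp (∑ i ∈ Finset.range n, Y i) 2 P := memLp_finsetSum' _ fun i _ => hLi i
  have hvar : Var[∑ i ∈ Finset.range n, Y i; P] = n * τ ^ 2 := by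
    rw [IndepFun.variance_sum (fun i _ => hLi i) fun i _ j _ hij => hind.indepFun hij]
    simp [(hid _).variance_eq, hτ]
  have hmean : ∫ ω, (∑ i ∈ Finset.range n, Y i) ω ∂P = n * ν := by
    simp only [Finset.sum_apply]
    rw [integral_finsetSum _ fun i _ => (hLi i).integrable (by norm_num)]
    simp [(hid _).integral_eq, hν]
  rw [variance_eq_integral hS.aemeasurable, hmean] at hvar
  have hT : MemLp (fun ω => (∑ i ∈ Finset.range n, Y i) ω - n * ν) 2 P := hS.sub (memLp_const _)
  simp only [Finset.sum_apply] at hvar hT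
  have hi := (hT.integrable (by norm_num)).abs
  refine ⟨hi, ?_⟩
  have hn0 : 0 < √(n : ℝ) := Real.sqrt_pos.2 (by exact_mod_cast hn)
  have hn2 : √(n : ℝ) ^ 2 = n := Real.sq_sqrt (by positivity)
  set c := τ * √n with hc
  have hc0 : 0 < c := by positivity
  -- `|t| ≤ t² / (2 c) + c / 2`, where `c` is the standard deviation
  have hp : ∀ ω, |∑ i ∈ Finset.range n, Y i ω - n * ν|
      ≤ (∑ i ∈ Finset.range n, Y i ω - n * ν) ^ 2 * (1 / (2 * c)) + c / 2 := fun ω => by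
    rw [← sq_abs]
    generalize |∑ i ∈ Finset.range n, Y i ω - n * ν| = t
    have : t ^ 2 * (1 / (2 * c)) + c / 2 - t = (t - c) ^ 2 / (2 * c) := by field_simp; ring
    have : 0 ≤ (t - c) ^ 2 / (2 * c) := by positivity
    linarith
  refine (integral_mono hi ((hT.integrable_sq.mul_const _).add (integrable_const _)) hp).trans ?_
  rw [integral_add' (hT.integrable_sq.mul_const _) (integrable_const _), integral_mul_const, hvar]
  simp only [integral_const, probReal_univ, one_smul]
  refine le_of_eq ?_
  rw [← hn2, hc]
  field_simp
  ring

/-- Berry–Esseen for the sum of `m` variables, with the normalisation `σ * √m` replaced by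
`σ * √K`, at a cost proportional to `|m / K - 1|`. -/
lemma abs_sub_cdf_le_of_normalization {F : ℕ → ℝ → ℝ} {C μ σ ρ : ℝ} (hσ : 0 < σ)
    (hC : 0 ≤ C) (hρ : 0 ≤ ρ) (hF0 : ∀ m w, 0 ≤ F m w) (hF1 : ∀ m w, F m w ≤ 1)
    (hF : ∀ m : ℕ, 1 ≤ m → ∀ w,
      |F m w - cdf (gaussianReal 0 1) ((w - m * μ) / (σ * √m))| ≤ C * (ρ / √m))
    {K : ℝ} (hK : 0 < K) (m : ℕ) (w : ℝ) :
    |F m w - cdf (gaussianReal 0 1) ((w - m * μ) / (σ * √K))|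
      ≤ 2 * C * (ρ / √K) + 2 * |m / K - 1| := by
  have hK0 : 0 < √K := Real.sqrt_pos.2 hK
  have hK2 : √K ^ 2 = K := Real.sq_sqrt hK.le
  -- for `m < K / 2` the right-hand side is at least `1`
  rcases lt_or_ge ((m : ℝ) / K) (1 / 2) with h | h
  · have h1 : |F m w - cdf (gaussianReal 0 1) ((w - m * μ) / (σ * √K))| ≤ 1 := by
      rw [abs_le]
      constructor <;> linarith [hF0 m w, hF1 m w, cdf_nonneg (gaussianReal 0 1) ((w - m * μ) / (σ * √K)),
        cdf_le_one (gaussianReal 0 1) ((w - m * μ) / (σ * √K))]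
    have h2 : 1 / 2 ≤ |m / K - 1| := by rw [abs_of_neg (by linarith)]; linarith
    have h3 : 0 ≤ 2 * C * (ρ / √K) := by positivity
    linarith
  · have hm0 : 0 < (m : ℝ) := by
      rw [le_div_iff₀ hK] at h
      linarith
    have hm1 : 1 ≤ m := by exact_mod_cast hm0
    have hs0 : 0 < √(m : ℝ) := Real.sqrt_pos.2 hm0
    have hs2 : √(m : ℝ) ^ 2 = m := Real.sq_sqrt hm0.le
    set l := √(m : ℝ) / √K with hl
    have hl0 : 0 < l := by positivity
    have hl2 : l ^ 2 = m / K := by rw [hl, div_pow, hs2, hK2]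
    have hl1 : 1 / 2 ≤ l := by nlinarith
    have e : (w - m * μ) / (σ * √K) = l * ((w - m * μ) / (σ * √m)) := by
      rw [hl]; field_simp
    have h1 := abs_cdf_gaussianReal_mul_sub_le hl1 ((w - m * μ) / (σ * √m))
    have h2 := hF m hm1 w
    have h3 : |l - 1| ≤ |m / K - 1| := by
      rw [← hl2, show l ^ 2 - 1 = (l - 1) * (l + 1) by ring, abs_mul]
      refine le_mul_of_one_le_right (abs_nonneg _) ?_
      rw [abs_of_pos (by linarith)]; linarith
    have h4 : C * (ρ / √m) ≤ 2 * C * (ρ / √K) := by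
      have : ρ / √m ≤ 2 * (ρ / √K) := by
        rw [← mul_div_assoc, div_le_div_iff₀ hs0 hK0]
        have : √K ≤ 2 * √m := by
          rw [hl, le_div_iff₀ hK0] at hl1; linarith
        nlinarith
      nlinarith
    rw [e]
    rw [abs_sub_comm] at h1
    calc _ ≤ _ := abs_sub_le _ (cdf (gaussianReal 0 1) ((w - m * μ) / (σ * √m))) _
      _ ≤ _ := by linarith

/-- The bound `abs_sub_cdf_le_of_normalization`, averaged over a random number `N` of terms. -/
lemma abs_integral_comp_sub_cdf_le {Ω : Type u} [MeasurableSpace Ω] {P : Measure Ω}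
    [IsProbabilityMeasure P] {F : ℕ → ℝ → ℝ} {C μ σ ρ : ℝ} (hσ : 0 < σ)
    (hC : 0 ≤ C) (hρ : 0 ≤ ρ) (hF0 : ∀ m w, 0 ≤ F m w) (hF1 : ∀ m w, F m w ≤ 1)
    (hF : ∀ m : ℕ, 1 ≤ m → ∀ w,
      |F m w - cdf (gaussianReal 0 1) ((w - m * μ) / (σ * √m))| ≤ C * (ρ / √m))
    {K B : ℝ} (hK : 0 < K) {N : Ω → ℕ} (hN : Measurable N)
    (hNi : Integrable (fun ω => |(N ω : ℝ) - K|) P) (hNB : ∫ ω, |(N ω : ℝ) - K| ∂P ≤ B) (w : ℝ) :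
    |∫ ω, F (N ω) w ∂P - ∫ ω, cdf (gaussianReal 0 1) ((w - N ω * μ) / (σ * √K)) ∂P|
      ≤ 2 * C * (ρ / √K) + 2 * (B / K) := by
  have hFm : Measurable fun m : ℕ => F m w := Measurable.of_discrete
  have hi1 : Integrable (fun ω => F (N ω) w) P :=
    Integrable.of_bound (hFm.comp hN).aestronglyMeasurable 1 (ae_of_all _ fun ω => by
      rw [Real.norm_eq_abs, abs_of_nonneg (hF0 _ _)]; exact hF1 _ _)
  have hG : Measurable fun m : ℕ => cdf (gaussianReal 0 1) ((w - m * μ) / (σ * √K)) :=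
    Measurable.of_discrete
  have hi2 : Integrable (fun ω => cdf (gaussianReal 0 1) ((w - N ω * μ) / (σ * √K))) P :=
    Integrable.of_bound (hG.comp hN).aestronglyMeasurable 1 (ae_of_all _ fun ω => by
      rw [Real.norm_eq_abs, abs_of_nonneg (cdf_nonneg _ _)]; exact cdf_le_one _ _)
  have hb : ∀ ω, |F (N ω) w - cdf (gaussianReal 0 1) ((w - N ω * μ) / (σ * √K))|
      ≤ 2 * C * (ρ / √K) + 2 / K * |(N ω : ℝ) - K| := fun ω => by
    have := abs_sub_cdf_le_of_normalization hσ hC hρ hF0 hF1 hF hK (N ω) w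
    have e : |(N ω : ℝ) / K - 1| = 1 / K * |(N ω : ℝ) - K| := by
      rw [show (N ω : ℝ) / K - 1 = 1 / K * ((N ω : ℝ) - K) by field_simp, abs_mul,
        abs_of_pos (one_div_pos.2 hK)]
    rw [e] at this
    refine this.trans (le_of_eq ?_)
    ring
  have hi3 := hNi.const_mul (2 / K)
  rw [← integral_sub hi1 hi2]
  calc _ ≤ ∫ ω, |F (N ω) w - cdf (gaussianReal 0 1) ((w - N ω * μ) / (σ * √K))| ∂P :=
        abs_integral_le_integral_abs
    _ ≤ ∫ ω, (2 * C * (ρ / √K) + 2 / K * |(N ω : ℝ) - K|) ∂P :=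
        integral_mono (hi1.sub hi2).abs ((integrable_const _).add hi3) hb
    _ = 2 * C * (ρ / √K) + 2 / K * ∫ ω, |(N ω : ℝ) - K| ∂P := by
        rw [integral_add (integrable_const _) hi3, integral_const_mul (2 / K)]
        simp
    _ ≤ 2 * C * (ρ / √K) + 2 / K * B := by gcongr
    _ = _ := by ring

/-- The change of normalisation costs `2 * (τ / ν)`, which is bounded by the other terms because
`2 * (τ / ν) ≤ 1 + τ ^ 2 / ν ^ 2` and `1 ≤ 8 * ρ'`. -/
lemma random_sum_error_le {C ρ ρ' τ ν n e : ℝ} (hC : 0 ≤ C) (hρ : 0 ≤ ρ) (hρ' : 1 ≤ 8 * ρ')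
    (hν : 0 < ν) (hn : 0 < n) (he : 0 ≤ e) :
    2 * C * (ρ / (√n * √ν)) + 2 * (τ * √n / (n * ν)) + C * (ρ' / √n)
      ≤ (2 * C + 8) * n ^ (-(1 / 2) : ℝ) * (τ ^ 2 / ν ^ 2 + ρ' + ρ / √ν + e) := by
  have hr0 : 0 < √n := Real.sqrt_pos.2 hn
  have hsν : 0 < √ν := Real.sqrt_pos.2 hν
  have hpow : n ^ (-(1 / 2) : ℝ) = 1 / √n := by
    rw [Real.rpow_neg hn.le, ← Real.sqrt_eq_rpow, one_div]
  have hτν : 2 * (τ / ν) ≤ τ ^ 2 / ν ^ 2 + 8 * ρ' := by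
    rw [← div_pow]; nlinarith [sq_nonneg (τ / ν - 1)]
  have e1 : 2 * C * (ρ / (√n * √ν)) + 2 * (τ * √n / (n * ν)) + C * (ρ' / √n)
      = 1 / √n * (2 * C * (ρ / √ν) + 2 * (τ / ν) + C * ρ') := by
    have : τ * √n / (n * ν) = τ / (√n * ν) := by
      nth_rewrite 2 [← Real.sq_sqrt hn.le]
      field_simp
    rw [this]; field_simp
  rw [hpow, e1, mul_comm (2 * C + 8), mul_assoc (1 / √n)]
  refine mul_le_mul_of_nonneg_left ?_ (by positivity)
  have h1 : 0 ≤ ρ / √ν := by positivity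
  have h3 : 0 ≤ τ ^ 2 / ν ^ 2 := by positivity
  have h4 : 0 ≤ ρ' := by linarith
  nlinarith [mul_nonneg hC h1, mul_nonneg hC he, mul_nonneg hC h3, mul_nonneg hC h4]

/-- Let `N` be approximately normal with mean `a` and standard deviation `s`. The integral is the
distribution function of `μ * N + q * Z` with `Z` standard normal and independent of `N`;
conditioning on `Z` instead of `N` shows that it is as close to normal as `N` is. -/
lemma abs_integral_cdf_sub_cdf_le {Ω : Type u} [MeasurableSpace Ω] {P : Measure Ω}
    [IsProbabilityMeasure P] {N : Ω → ℝ} (hN : Measurable N) {a μ s B : ℝ} {q : ℝ} (hμ : 0 < μ)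
    (hs : 0 < s) (hq : 0 < q)
    (hB : ∀ w, |P.real {ω | N ω ≤ w} - cdf (gaussianReal 0 1) ((w - a) / s)| ≤ B) (w : ℝ) :
    |∫ ω, cdf (gaussianReal 0 1) ((w - N ω * μ) / q) ∂P
      - cdf (gaussianReal 0 1) ((w - a * μ) / √(q ^ 2 + (s * μ) ^ 2))| ≤ B := by
  set v : NNReal := (Real.toNNReal q) ^ 2 with hv
  set v' : NNReal := (Real.toNNReal (s * μ)) ^ 2 with hv'
  have hvR : (v : ℝ) = q ^ 2 := by rw [hv, NNReal.coe_pow, Real.coe_toNNReal _ hq.le]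
  have hvR' : (v' : ℝ) = (s * μ) ^ 2 := by
    rw [hv', NNReal.coe_pow, Real.coe_toNNReal _ (by positivity)]
  have hv0 : v ≠ 0 := by rw [← NNReal.coe_ne_zero, hvR]; positivity
  have hv0' : v' ≠ 0 := by rw [← NNReal.coe_ne_zero, hvR']; positivity
  have hg : Measurable fun ω => (N ω - a) * μ := by fun_prop
  set Λ := P.map fun ω => (N ω - a) * μ with hΛ
  have : IsProbabilityMeasure Λ := Measure.isProbabilityMeasure_map hg.aemeasurable
  have e1 : ∫ ω, cdf (gaussianReal 0 1) ((w - N ω * μ) / q) ∂P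
      = cdf (Λ ∗ gaussianReal 0 v) (w - a * μ) := by
    have hm : Measurable fun u => cdf (gaussianReal 0 v) (w - a * μ - u) :=
      (measurable_cdf _).comp (by fun_prop)
    rw [Measure.conv_comm, cdf_conv, hΛ, integral_map hg.aemeasurable hm.aestronglyMeasurable]
    congr 1
    ext ω
    rw [cdf_gaussianReal_eq hv0, hvR, Real.sqrt_sq hq.le]
    congr 2; ring
  have e2 : cdf (gaussianReal 0 1) ((w - a * μ) / √(q ^ 2 + (s * μ) ^ 2))
      = cdf (gaussianReal 0 v' ∗ gaussianReal 0 v) (w - a * μ) := by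
    rw [gaussianReal_zero_conv, cdf_gaussianReal_eq (v := v' + v) (by positivity), NNReal.coe_add, hvR, hvR',
      add_comm]
  rw [e1, e2]
  refine abs_cdf_conv_sub_le (fun x => ?_) _
  have := hB (a + x / μ)
  rw [cdf_gaussianReal_eq hv0', hvR', Real.sqrt_sq (by positivity), cdf_eq_real, hΛ,
    map_measureReal_apply hg measurableSet_Iic]
  convert this using 4
  · ext ω
    simp only [Set.mem_preimage, Set.mem_Iic, Set.mem_ofPred_eq]
    rw [← le_div_iff₀ hμ, sub_le_iff_le_add']
  · rw [add_sub_cancel_left, div_div, mul_comm s]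

/-- Uniform Berry–Esseen bound for a random sum of i.i.d. variables, with one absolute constant `C`.
The sequences are indexed from `0`, so `X 0`, `Y 0` are the first variables, the number of
summands is `∑ j ∈ Finset.range n, Y j ω`, and `cdf (gaussianReal 0 1)` is the standard normal
distribution function. -/
theorem theorem2p4 :
    ∃ C : ℝ, 0 < C ∧
      ∀ (Ω : Type u) [MeasurableSpace Ω] (P : Measure Ω) [IsProbabilityMeasure P]
        (X : ℕ → Ω → ℝ) (Y : ℕ → Ω → ℕ) (μ σ ν τ : ℝ),
        (∀ i, Measurable (X i)) → (∀ i, Measurable (Y i)) →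
        -- the `X i` are i.i.d., the `Y i` are i.i.d., and the two sequences are independent
        iIndepFun X P → (∀ i, IdentDistrib (X i) (X 0) P P) →
        iIndepFun Y P → (∀ i, IdentDistrib (Y i) (Y 0) P P) →
        IndepFun (fun ω i => X i ω) (fun ω i => Y i ω) P →
        Integrable (fun ω => |X 0 ω| ^ 3) P →
        Integrable (fun ω => (Y 0 ω : ℝ) ^ 3) P →
        μ = ∫ ω, X 0 ω ∂P → 0 < μ →
        σ ^ 2 = Var[X 0; P] → 0 < σ →
        ν = ∫ ω, (Y 0 ω : ℝ) ∂P → 0 < ν →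
        τ ^ 2 = Var[fun ω => (Y 0 ω : ℝ); P] → 0 < τ →
        ∀ n : ℕ, 1 ≤ n →
          (⨆ z : ℝ,
            |P.real {ω | (∑ i ∈ Finset.range (∑ j ∈ Finset.range n, Y j ω), X i ω - n * μ * ν)
                / √(n * (ν * σ ^ 2 + τ ^ 2 * μ ^ 2)) ≤ z}
              - cdf (gaussianReal 0 1) z|)
          ≤ C * (n : ℝ) ^ (-(1 / 2) : ℝ) *
            (τ ^ 2 / ν ^ 2 + (∫ ω, (Y 0 ω : ℝ) ^ 3 ∂P) / τ ^ 3
              + (∫ ω, |X 0 ω| ^ 3 ∂P) / (ν ^ (1 / 2 : ℝ) * σ ^ 3) + σ / (μ * √ν)) := by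
  obtain ⟨C, hC, hBE⟩ := berry_esseen.{u}
  refine ⟨2 * C + 8, by positivity, ?_⟩
  intro Ω _ P _ X Y μ σ ν τ hX hY hXi hXd hYi hYd hXY hX3 hY3 hμ hμ0 hσ hσ0 hν hν0 hτ hτ0 n hn
  have hn0 : 0 < (n : ℝ) := by exact_mod_cast hn
  have hr0 : 0 < √(n : ℝ) := Real.sqrt_pos.2 hn0
  have hr2 : √(n : ℝ) ^ 2 = n := Real.sq_sqrt hn0.le
  -- the real-valued counterpart of `Y`
  have hcast : Measurable fun k : ℕ => (k : ℝ) := Measurable.of_discrete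
  have hZm : ∀ i, Measurable fun ω => (Y i ω : ℝ) := fun i => hcast.comp (hY i)
  have hZi : iIndepFun (fun i ω => (Y i ω : ℝ)) P :=
    hYi.comp (fun _ k => (k : ℝ)) fun _ => hcast
  have hZd : ∀ i, IdentDistrib (fun ω => (Y i ω : ℝ)) (fun ω => (Y 0 ω : ℝ)) P P :=
    fun i => (hYd i).comp hcast
  have hZabs : (fun ω => |(Y 0 ω : ℝ)| ^ 3) = fun ω => (Y 0 ω : ℝ) ^ 3 := by
    ext ω; rw [Nat.abs_cast]
  have hZ3 : Integrable (fun ω => |(Y 0 ω : ℝ)| ^ 3) P := by rw [hZabs]; exact hY3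
  obtain ⟨-, -, -, -, hY1⟩ := standardized_moments (hZm 0) hZ3 hν hτ hτ0
  have hBX := hBE Ω P X μ σ hX hXi hXd hX3 hμ hσ hσ0
  have hBY := hBE Ω P (fun i ω => (Y i ω : ℝ)) ν τ hZm hZi hZd hZ3 hν hτ hτ0 n hn
  obtain ⟨hdi, hd⟩ := integral_abs_sum_sub_le hZi hZd
    (memLp_two_of_integrable_abs_pow (hZm 0) hZ3) hν hτ hτ0 hn
  rw [hZabs] at hY1 hBY
  set ρX := (∫ ω, |X 0 ω| ^ 3 ∂P) / σ ^ 3 with hρX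
  set ρY := (∫ ω, (Y 0 ω : ℝ) ^ 3 ∂P) / τ ^ 3 with hρY
  have hρX0 : 0 ≤ ρX := div_nonneg (integral_nonneg fun ω => by positivity) (by positivity)
  -- the number of summands
  set N : Ω → ℕ := fun ω => ∑ j ∈ Finset.range n, Y j ω with hN
  have hNm : Measurable N := Finset.measurable_sum _ fun j _ => hY j
  have hNR : ∀ ω, (N ω : ℝ) = ∑ j ∈ Finset.range n, (Y j ω : ℝ) := fun ω => by simp [hN]
  have hXN : IndepFun (fun ω i => X i ω) N P := by
    have hg : Measurable fun y : ℕ → ℕ => ∑ j ∈ Finset.range n, y j :=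
      Finset.measurable_sum _ fun j _ => measurable_pi_apply j
    exact hXY.comp measurable_id hg
  simp only [← hNR] at hBY hd hdi
  set K := n * ν with hK
  have hK0 : 0 < K := by positivity
  have hsK : √K = √n * √ν := Real.sqrt_mul hn0.le ν
  refine ciSup_le fun z => ?_
  have hV : √(n * (ν * σ ^ 2 + τ ^ 2 * μ ^ 2)) = √((σ * √K) ^ 2 + (τ * √n * μ) ^ 2) := by
    congr 1
    rw [mul_pow, mul_pow, mul_pow, Real.sq_sqrt hK0.le, hr2, hK]; ring
  have hV0 : 0 < √((σ * √K) ^ 2 + (τ * √n * μ) ^ 2) := by positivity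
  rw [hV]
  set V := √((σ * √K) ^ 2 + (τ * √n * μ) ^ 2) with hVdef
  set w := z * V + K * μ with hw
  have hset : {ω | (∑ i ∈ Finset.range (N ω), X i ω - n * μ * ν) / V ≤ z}
      = {ω | ∑ i ∈ Finset.range (N ω), X i ω ≤ w} := by
    ext ω
    simp only [Set.mem_ofPred_eq]
    rw [div_le_iff₀ hV0, sub_le_iff_le_add, hw, hK, show n * μ * ν = n * ν * μ by ring]
  have hz : z = (w - K * μ) / V := by rw [hw]; field_simp; ring
  rw [hset, measureReal_random_sum_le hX hNm hXN w]
  -- normal approximation of the sum given its number of terms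
  have hstep1 := abs_integral_comp_sub_cdf_le
    (F := fun m w => P.real {ω' | ∑ i ∈ Finset.range m, X i ω' ≤ w}) hσ0 hC.le hρX0
    (fun _ _ => measureReal_nonneg) (fun _ _ => measureReal_le_one) hBX hK0 hNm hdi hd w
  -- normal approximation of the number of terms
  have hstep2 := abs_integral_cdf_sub_cdf_le (hcast.comp hNm) (q := σ * √K) hμ0
    (mul_pos hτ0 hr0) (by positivity) hBY w
  simp only [Function.comp_apply] at hstep2
  rw [← hVdef, ← hz] at hstep2
  refine (abs_sub_le _ _ _).trans ((add_le_add hstep1 hstep2).trans ?_)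
  have eX : (∫ ω, |X 0 ω| ^ 3 ∂P) / (√ν * σ ^ 3) = ρX / √ν := by
    rw [hρX, div_div, mul_comm]
  rw [← Real.sqrt_eq_rpow, eX, hsK]
  exact random_sum_error_le hC.le hρX0 hY1 hν0 hn0 (by positivity)
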